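/- Let $S^3=\{(x,y,z,w)\in\mathbb R^4 : x^2+y^2+z^2+w^2=1\}$ be the unit 3-sphere with its round metric, volume element $dV$ and Laplacian $\nabla^2=\operatorname{div}\operatorname{grad}$, and let toroidal coordinates $0\le\chi\le\pi/2$, $\theta,\varphi\in\mathbb R$ (modulo $2\pi$) parametrize it by $$x=\cos\chi\cos\theta,\quad y=\cos\chi\sin\theta,\quad z=\sin\chi\cos\varphi,\quad w=\sin\chi\sin\varphi .$$ For integers $k\ge 0$, $\ell$, $m$ with $|\ell|+|m|\le k$ and $\ell+m\equiv k\pmod 2$ put $d=\tfrac12\bigl(k-(|\ell|+|m|)\bigr)$, $$P_d^{(|m|,|\ell|)}(u)=\frac1{2^d}\sum_{i=0}^d\binom{|m|+d}{i}\binom{|\ell|+d}{d-i}(u+1)^i(u-1)^{d-i},$$ let $\Theta_\ell(\theta)=\cos|\ell|\theta$ if $\ell\ge0$ and $\sin|\ell|\theta$ if $\ell<0$, let $\Phi_m(\varphi)=\cos|m|\varphi$ if $m\ge0$ and $\sin|m|\varphi$ if $m<0$, let $\hat n=1$ if $n=0$ and $\hat n=0$ if $n\neq0$, and define $$\Psi_{k\ell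 m}(\chi,\theta,\varphi)=\frac{\cos^{|\ell|}\chi\,\sin^{|m|}\chi\;P_d^{(|m|,|\ell|)}(\cos2\chi)\;\Theta_\ell(\theta)\,\Phi_m(\varphi)}{\sqrt{2^{\hat\ell+\hat m}}\;\pi\;\sqrt{\dfrac{(|\ell|+d)!\,(|m|+d)!}{2(k+1)\,d!\,(|\ell|+|m|+d)!}}}\,.$$ **Theorem 1.** Each $\Psi_{k\ell m}$ is a well-defined function on $S^3$. For every integer $k\ge0$, the functions $\Psi_{k\ell m}$, taken over all integers $\ell,m$ with $|\ell|+|m|\le k$ and $\ell+m\equiv k\pmod 2$, form a basis, orthonormal for $\langle f,g\rangle=\int_{S^3}fg\,dV$, of the eigenspace $\{f\in C^\infty(S^3,\mathbb R):\nabla^2f=-k(k+2)f\}$. Taken over all such $k,\ell,m$ together, they form an orthonormal basis (orthonormal, linearly independent and spanning by finite linear combinations) of the space spanned by all smooth real eigenfunctions of the Laplacian on $S^3$. -/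

import Mathlib

open scoped ContDiff Manifold

noncomputable section

namespace ToroidalModes

/-- Euclidean 4-space, with coordinates `x = p 0`, `y = p 1`, `z = p 2`, `w = p 3`. -/
abbrev R4 : Type := EuclideanSpace ℝ (Fin 4)

/-- The unit 3-sphere `x² + y² + z² + w² = 1`. -/
abbrev S3 : Type := Metric.sphere (0 : R4) 1

/-! ### The Laplacian of the round 3-sphere, as divergence of the gradient -/

/-- The extension of a map on `S3` to `ℝ⁴ ∖ {0}` that is constant along rays from the origin
(with the value `0` at the origin). Its derivative at a point `p` of the sphere vanishes on the
normal line `ℝ p` and is the intrinsic derivative on the tangent space. -/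
def radialExt {F : Type*} [Zero F] (f : S3 → F) (x : R4) : F :=
  open Classical in
  if h : x ≠ 0 then
    f ⟨‖x‖⁻¹ • x, by simp [norm_smul, inv_mul_cancel₀ (norm_ne_zero_iff.mpr h)]⟩
  else 0

/-- The Riemannian gradient of `f` on `S3`: a tangent vector field, with values in `ℝ⁴`. -/
def sphereGrad (f : S3 → ℝ) (p : S3) : R4 :=
  gradient (radialExt f) (p : R4)

/-- The Riemannian divergence of a tangent vector field `V` on `S3`: the trace of the derivative of
`V` (the normal direction contributes `0` to the trace, as `radialExt V` is constant along it). -/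
def sphereDiv (V : S3 → R4) (p : S3) : ℝ :=
  LinearMap.trace ℝ R4 (fderiv ℝ (radialExt V) (p : R4) : R4 →ₗ[ℝ] R4)

/-- The Laplacian (Laplace–Beltrami operator) of the unit sphere `S3`. -/
def sphereLaplacian (f : S3 → ℝ) (p : S3) : ℝ :=
  sphereDiv (sphereGrad f) p

/-- Smooth real functions on the 3-sphere. -/
def SmoothOnS3 (f : S3 → ℝ) : Prop :=
  ContMDiff (𝓡 3) 𝓘(ℝ, ℝ) ∞ f

/-! Facts needed to see that an eigenspace is a linear subspace. -/

instance : Fact (Module.finrank ℝ R4 = 3 + 1) := ⟨by simp⟩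

theorem contDiffAt_radialExt {f : S3 → ℝ} (hf : SmoothOnS3 f) {x : R4} (hx : x ≠ 0) :
    ContDiffAt ℝ ∞ (radialExt f) x := by
  let U : TopologicalSpace.Opens R4 := ⟨{0}ᶜ, isOpen_compl_singleton⟩
  have hU : ∀ y : U, (y : R4) ≠ 0 := fun y => y.2
  have h1 : ContMDiff 𝓘(ℝ, R4) 𝓘(ℝ, R4) ∞ (fun y : U => ‖(y : R4)‖⁻¹ • (y : R4)) := by
    intro y
    refine (contMDiffAt_subtype_iff (f := fun y : R4 => ‖y‖⁻¹ • y)).mpr ?_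
    refine ContDiffAt.contMDiffAt ?_
    exact ((contDiffAt_norm ℝ (hU y)).inv (norm_ne_zero_iff.mpr (hU y))).smul contDiffAt_id
  have h2 := h1.codRestrict_sphere (n := 3)
    (fun y => by simp [norm_smul, inv_mul_cancel₀ (norm_ne_zero_iff.mpr (hU y))])
  have h3 := hf.comp h2
  have h4 : ContMDiffAt 𝓘(ℝ, R4) 𝓘(ℝ, ℝ) ∞ (radialExt f) x := by
    refine (contMDiffAt_subtype_iff (U := U) (x := ⟨x, hx⟩)).mp ?_
    convert h3 ⟨x, hx⟩ using 1
    funext y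
    simp [radialExt, hU y]
    rfl
  exact h4.contDiffAt

theorem differentiableAt_radialExt_grad {f : S3 → ℝ} (hf : SmoothOnS3 f) {x : R4} (hx : x ≠ 0) :
    DifferentiableAt ℝ (radialExt (sphereGrad f)) x := by
  have hn : ‖x‖⁻¹ • x ≠ 0 := smul_ne_zero (inv_ne_zero (norm_ne_zero_iff.mpr hx)) hx
  have hG : DifferentiableAt ℝ (fun y : R4 => gradient (radialExt f) y) (‖x‖⁻¹ • x) := by
    have h := (contDiffAt_radialExt hf hn).fderiv_right (m := 1) (by norm_cast)
    exact ((InnerProductSpace.toDual ℝ R4).symm.toContinuousLinearEquiv.differentiableAt).comp _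
      (h.differentiableAt (by norm_num))
  have hr : DifferentiableAt ℝ (fun y : R4 => ‖y‖⁻¹ • y) x :=
    (((contDiffAt_norm ℝ (n := 1) hx).inv (norm_ne_zero_iff.mpr hx)).smul
      contDiffAt_id).differentiableAt (by norm_num)
  refine (DifferentiableAt.comp (f := fun y : R4 => ‖y‖⁻¹ • y) x hG hr).congr_of_eventuallyEq ?_
  filter_upwards [isOpen_ne.mem_nhds hx] with y hy
  have hy' : y ≠ 0 := hy
  simp [radialExt, hy', sphereGrad]

theorem ne_zero_S3 (p : S3) : (p : R4) ≠ 0 := ne_zero_of_mem_unit_sphere p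

theorem radialExt_add {F : Type*} [AddMonoid F] (f g : S3 → F) :
    radialExt (f + g) = radialExt f + radialExt g := by
  funext x
  by_cases h : x = 0 <;> simp [radialExt, h]

theorem radialExt_smul {F : Type*} [AddCommGroup F] [Module ℝ F] (c : ℝ) (f : S3 → F) :
    radialExt (c • f) = c • radialExt f := by
  funext x
  by_cases h : x = 0 <;> simp [radialExt, h]

theorem sphereLaplacian_add {f g : S3 → ℝ} (hf : SmoothOnS3 f) (hg : SmoothOnS3 g) (p : S3) :
    sphereLaplacian (f + g) p = sphereLaplacian f p + sphereLaplacian g p := by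
  have hgrad : sphereGrad (f + g) = sphereGrad f + sphereGrad g := by
    funext q
    have h1 := (contDiffAt_radialExt hf (ne_zero_S3 q)).differentiableAt (by simp)
    have h2 := (contDiffAt_radialExt hg (ne_zero_S3 q)).differentiableAt (by simp)
    simp [sphereGrad, gradient, radialExt_add, fderiv_add h1 h2]
  simp [sphereLaplacian, sphereDiv, hgrad, radialExt_add,
    fderiv_add (differentiableAt_radialExt_grad hf (ne_zero_S3 p))
      (differentiableAt_radialExt_grad hg (ne_zero_S3 p))]

theorem sphereLaplacian_smul {f : S3 → ℝ} (hf : SmoothOnS3 f) (c : ℝ) (p : S3) :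
    sphereLaplacian (c • f) p = c * sphereLaplacian f p := by
  have hgrad : sphereGrad (c • f) = c • sphereGrad f := by
    funext q
    have h1 := (contDiffAt_radialExt hf (ne_zero_S3 q)).differentiableAt (by simp)
    simp [sphereGrad, gradient, radialExt_smul, fderiv_const_smul h1]
  simp [sphereLaplacian, sphereDiv, hgrad, radialExt_smul,
    fderiv_const_smul (differentiableAt_radialExt_grad hf (ne_zero_S3 p))]

/-- The space of smooth functions `f` on the 3-sphere with `Δ f = μ f`. -/
def eigenspace (μ : ℝ) : Submodule ℝ (S3 → ℝ) where
  carrier := {f | SmoothOnS3 f ∧ ∀ p, sphereLaplacian f p = μ * f p}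
  add_mem' := by
    rintro f g ⟨hf, hf'⟩ ⟨hg, hg'⟩
    refine ⟨ContMDiff.add hf hg, fun p => ?_⟩
    rw [sphereLaplacian_add hf hg, hf', hg', Pi.add_apply, mul_add]
  zero_mem' := by
    have h0 : SmoothOnS3 (0 : S3 → ℝ) := contMDiff_const
    refine ⟨h0, fun p => ?_⟩
    have h := sphereLaplacian_smul h0 0 p
    simpa using h
  smul_mem' := by
    rintro c f ⟨hf, hf'⟩
    refine ⟨(contMDiff_const (c := c)).mul hf, fun p => ?_⟩
    rw [sphereLaplacian_smul hf, hf', Pi.smul_apply, smul_eq_mul]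
    ring

/-! ### The inner product of functions on the sphere -/

/-- `⟨f, g⟩ = ∫_{S³} f g dV`, for the surface measure of the unit sphere. -/
def sphereInner (f g : S3 → ℝ) : ℝ :=
  ∫ p : S3, f p * g p ∂((MeasureTheory.volume : MeasureTheory.Measure R4).toSphere)

/-- The family `v` is an orthonormal basis of the space `W` of functions on `S3`: it is orthonormal,
linearly independent, and its linear span is `W`. -/
def IsOrthonormalBasisOf {ι : Type*} (v : ι → S3 → ℝ) (W : Submodule ℝ (S3 → ℝ)) : Prop :=
  (∀ i, sphereInner (v i) (v i) = 1) ∧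
  (∀ i j, i ≠ j → sphereInner (v i) (v j) = 0) ∧
  LinearIndependent ℝ v ∧
  Submodule.span ℝ (Set.range v) = W

/-! ### Toroidal coordinates -/

/-- The parametrization of the 3-sphere by toroidal coordinates. -/
def torPoint (χ θ φ : ℝ) : S3 :=
  ⟨!₂[Real.cos χ * Real.cos θ, Real.cos χ * Real.sin θ,
      Real.sin χ * Real.cos φ, Real.sin χ * Real.sin φ], by
    simp only [mem_sphere_iff_norm, sub_zero, EuclideanSpace.norm_eq, Fin.sum_univ_four,
      Real.norm_eq_abs, sq_abs, Real.sqrt_eq_one]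
    simp
    linear_combination (Real.cos χ) ^ 2 * Real.sin_sq_add_cos_sq θ +
      (Real.sin χ) ^ 2 * Real.sin_sq_add_cos_sq φ + Real.sin_sq_add_cos_sq χ⟩

/-- The coordinate `χ ∈ [0, π/2]` of a point. -/
def coordChi (p : S3) : ℝ :=
  Real.arccos (Real.sqrt ((p : R4) 0 ^ 2 + (p : R4) 1 ^ 2))

/-- The coordinate `θ` of a point, taken in `(-π, π]`; it is `0` where `x = y = 0`. -/
def coordTheta (p : S3) : ℝ :=
  Complex.arg ⟨(p : R4) 0, (p : R4) 1⟩

/-- The coordinate `φ` of a point, taken in `(-π, π]`; it is `0` where `z = w = 0`. -/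
def coordPhi (p : S3) : ℝ :=
  Complex.arg ⟨(p : R4) 2, (p : R4) 3⟩

/-! ### The modes -/

/-- The Jacobi polynomial `P_d^{(a,b)}(u)` for natural numbers `a`, `b`, `d`. -/
def jacobiP (a b d : ℕ) (u : ℝ) : ℝ :=
  1 / 2 ^ d * ∑ i ∈ Finset.range (d + 1),
    ((a + d).choose i : ℝ) * ((b + d).choose (d - i) : ℝ) * (u + 1) ^ i * (u - 1) ^ (d - i)

/-- The circular harmonic: `cos |n|t` for `n ≥ 0`, `sin |n|t` for `n < 0`. -/
def circHarmonic (n : ℤ) (t : ℝ) : ℝ :=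
  if 0 ≤ n then Real.cos (n.natAbs * t) else Real.sin (n.natAbs * t)

/-- `d = (k - (|ℓ| + |m|)) / 2`, an exact division of a nonnegative number for the indices of
`ModeIndex k`. -/
def modeDeg (k : ℕ) (l m : ℤ) : ℕ :=
  (k - (l.natAbs + m.natAbs)) / 2

/-- The unnormalized mode in toroidal coordinates. -/
def modeTilde (k : ℕ) (l m : ℤ) (χ θ φ : ℝ) : ℝ :=
  Real.cos χ ^ l.natAbs * Real.sin χ ^ m.natAbs *
    jacobiP m.natAbs l.natAbs (modeDeg k l m) (Real.cos (2 * χ)) *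
    circHarmonic l θ * circHarmonic m φ

/-- `1` if `n = 0`, and `0` otherwise. -/
def hat (n : ℤ) : ℕ := if n = 0 then 1 else 0

/-- The normalization constant. -/
def modeNorm (k : ℕ) (l m : ℤ) : ℝ :=
  Real.sqrt (2 ^ (hat l + hat m)) * Real.pi *
    Real.sqrt
      (((l.natAbs + modeDeg k l m).factorial * (m.natAbs + modeDeg k l m).factorial : ℝ) /
        (2 * ((k : ℝ) + 1) * (modeDeg k l m).factorial *
          (l.natAbs + m.natAbs + modeDeg k l m).factorial))

/-- The normalized mode in toroidal coordinates. -/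
def modeCoord (k : ℕ) (l m : ℤ) (χ θ φ : ℝ) : ℝ :=
  modeTilde k l m χ θ φ / modeNorm k l m

/-- The normalized mode `Ψ_{kℓm}` as a function on the 3-sphere. -/
def mode (k : ℕ) (l m : ℤ) (p : S3) : ℝ :=
  modeCoord k l m (coordChi p) (coordTheta p) (coordPhi p)

/-- Pairs `(ℓ, m)` of integers with `|ℓ| + |m| ≤ k` and `ℓ + m ≡ k (mod 2)`. -/
abbrev ModeIndex (k : ℕ) : Type :=
  {q : ℤ × ℤ // |q.1| + |q.2| ≤ (k : ℤ) ∧ q.1 + q.2 ≡ (k : ℤ) [ZMOD 2]}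

end ToroidalModes

end

/-! Put `ζ = x + iy`, `η = z + iw`, `s = |ζ|²`, `t = |η|²`. Up to its constant, a mode is the
restriction to the sphere of (Re or Im of `ζ^|ℓ|`) · (Re or Im of `η^|m|`) · `J(s, t)`, where `J` is
the Jacobi polynomial made homogeneous by `s + t = 1` (`mode_eq_modeFun`). Hence it does not depend
on the choice of coordinates. This form has degree `k` and is harmonic, because consecutive
coefficients of `J` satisfy a two-term recurrence (`modePoly_harmonic`). A harmonic form of degree
`k` restricts to an eigenfunction for `-k(k+2)` (`sphereLaplacian_eval`).

For orthonormality, a Gaussian integral over `ℝ⁴`, computed both in polar coordinates and as a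
product over two planes, gives the moments of the sphere (`integral_sphereMoment_mul_Gamma`).
Pairing a Jacobi polynomial with a power of `s` then becomes a `d`-th finite difference of a
binomial coefficient: zero below degree `d`, explicit at degree `d`
(`harmInt_jacobiPoly_mul_X_pow`).

For spanning, the span of all modes contains `1` and is stable under multiplication by coordinates,
so it contains every polynomial function. By Stone–Weierstrass, a continuous function orthogonal to
all modes vanishes (`eq_zero_of_sphereInner_allModes`). The Laplacian is symmetric
(`sphereInner_sphereLaplacian_comm`), so an eigenfunction is orthogonal to the modes of every other
eigenvalue. Subtracting its projection on the finitely many modes of its own eigenvalue leaves zero.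
-/

open scoped ContDiff Manifold

noncomputable section

namespace ToroidalModes

/-! ### Plane harmonics and Jacobi forms over a commutative ring -/

section Algebra

variable {R S : Type*} [CommRing R] [CommRing S]

/-- The real and imaginary parts of `(x + i y) ^ n`, in any commutative ring. -/
def planePow (x y : R) : ℕ → R × R
  | 0 => (1, 0)
  | n + 1 => (x * (planePow x y n).1 - y * (planePow x y n).2,
      x * (planePow x y n).2 + y * (planePow x y n).1)

/-- The harmonic form of degree `|l|` in the plane: the real part of `(x + i y) ^ |l|` for `l ≥ 0`
and the imaginary part for `l < 0`. -/
def planeHarm (x y : R) (l : ℤ) : R :=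
  if 0 ≤ l then (planePow x y l.natAbs).1 else (planePow x y l.natAbs).2

/-- The homogeneous form of degree `d` whose restriction to `s + t = 1` is the Jacobi polynomial
`P_d^{(a,b)}(s - t)`. -/
def jacobiForm (a b d : ℕ) (s t : R) : R :=
  ∑ i ∈ Finset.range (d + 1),
    ((a + d).choose i : R) * ((b + d).choose (d - i) : R) * s ^ i * (-t) ^ (d - i)

/-- The unnormalized mode as a form of degree `|l| + |m| + 2 d` in four variables. -/
def modeForm (l m : ℤ) (d : ℕ) (x y z w : R) : R :=
  planeHarm x y l * planeHarm z w m *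
    jacobiForm m.natAbs l.natAbs d (x ^ 2 + y ^ 2) (z ^ 2 + w ^ 2)

/-- Naturality in the ring lets one formula serve as a polynomial to differentiate, as a function on
the sphere, and as a polynomial in `s` alone. -/
theorem map_planePow (f : R →+* S) (x y : R) (n : ℕ) :
    f (planePow x y n).1 = (planePow (f x) (f y) n).1 ∧
      f (planePow x y n).2 = (planePow (f x) (f y) n).2 := by
  induction n with
  | zero => simp [planePow]
  | succ n ih => simp [planePow, ih.1, ih.2]

theorem map_planeHarm (f : R →+* S) (x y : R) (l : ℤ) :
    f (planeHarm x y l) = planeHarm (f x) (f y) l := by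
  unfold planeHarm
  split_ifs
  exacts [(map_planePow f x y _).1, (map_planePow f x y _).2]

theorem map_jacobiForm (f : R →+* S) (a b d : ℕ) (s t : R) :
    f (jacobiForm a b d s t) = jacobiForm a b d (f s) (f t) := by
  simp [jacobiForm]

theorem map_modeForm (f : R →+* S) (l m : ℤ) (d : ℕ) (x y z w : R) :
    f (modeForm l m d x y z w) = modeForm l m d (f x) (f y) (f z) (f w) := by
  simp [modeForm, map_planeHarm, map_jacobiForm]

theorem planePow_mul (c x y : R) (n : ℕ) :
    planePow (c * x) (c * y) n = (c ^ n * (planePow x y n).1, c ^ n * (planePow x y n).2) := by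
  induction n with
  | zero => simp [planePow]
  | succ n ih => simp only [planePow, ih]; ext <;> ring

theorem planeHarm_mul (c x y : R) (l : ℤ) :
    planeHarm (c * x) (c * y) l = c ^ l.natAbs * planeHarm x y l := by
  unfold planeHarm
  split_ifs <;> simp [planePow_mul]

/-! Derivatives of the plane harmonics. -/

/-- Real and imaginary parts of `D(ζ^(n+1)) = (n+1) ζ^n (Dx + i Dy)`. -/
theorem derivation_planePow [Algebra ℝ R] (D : Derivation ℝ R R) (x y : R) (n : ℕ) :
    D (planePow x y (n + 1)).1 =
        (n + 1) * ((planePow x y n).1 * D x - (planePow x y n).2 * D y) ∧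
      D (planePow x y (n + 1)).2 =
        (n + 1) * ((planePow x y n).1 * D y + (planePow x y n).2 * D x) := by
  induction n with
  | zero => simp [planePow]
  | succ n ih =>
    obtain ⟨h1, h2⟩ := ih
    rw [planePow]
    simp only [map_sub, map_add, Derivation.leibniz, smul_eq_mul, h1, h2]
    simp only [planePow]
    push_cast
    constructor <;> ring

theorem planePow_euler [Algebra ℝ R] (D E : Derivation ℝ R R) {x y : R} (hDx : D x = 1)
    (hDy : D y = 0) (hEx : E x = 0) (hEy : E y = 1) (n : ℕ) :
    x * D (planePow x y n).1 + y * E (planePow x y n).1 = n * (planePow x y n).1 ∧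
      x * D (planePow x y n).2 + y * E (planePow x y n).2 = n * (planePow x y n).2 := by
  cases n with
  | zero => simp [planePow]
  | succ n =>
    simp only [derivation_planePow, hDx, hDy, hEx, hEy]
    simp only [planePow]
    push_cast
    constructor <;> ring

/-- `D` and `E` act as `∂/∂x` and `∂/∂y`; the second `y`-derivative of `ζ^n` is `i² = -1` times the
second `x`-derivative. -/
theorem planePow_harmonic [Algebra ℝ R] (D E : Derivation ℝ R R) {x y : R} (hDx : D x = 1)
    (hDy : D y = 0) (hEx : E x = 0) (hEy : E y = 1) (n : ℕ) :
    D (D (planePow x y n).1) + E (E (planePow x y n).1) = 0 ∧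
      D (D (planePow x y n).2) + E (E (planePow x y n).2) = 0 := by
  have hc (D : Derivation ℝ R R) (n : ℕ) : D (n : R) = 0 := D.map_natCast n
  rcases n with _ | _ | n
  · simp [planePow]
  · simp [planePow, hDx, hDy, hEx, hEy]
  · simp only [derivation_planePow, hDx, hDy, hEx, hEy, Derivation.leibniz, map_add,
      hc, smul_eq_mul, mul_one, mul_zero, sub_zero, zero_sub, map_neg]
    simp

theorem planeHarm_euler [Algebra ℝ R] (D E : Derivation ℝ R R) {x y : R} (hDx : D x = 1)
    (hDy : D y = 0) (hEx : E x = 0) (hEy : E y = 1) (l : ℤ) :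
    x * D (planeHarm x y l) + y * E (planeHarm x y l) = l.natAbs * planeHarm x y l := by
  have h := planePow_euler D E hDx hDy hEx hEy l.natAbs
  unfold planeHarm
  split_ifs
  exacts [h.1, h.2]

theorem planeHarm_harmonic [Algebra ℝ R] (D E : Derivation ℝ R R) {x y : R} (hDx : D x = 1)
    (hDy : D y = 0) (hEx : E x = 0) (hEy : E y = 1) (l : ℤ) :
    D (D (planeHarm x y l)) + E (E (planeHarm x y l)) = 0 := by
  have h := planePow_harmonic D E hDx hDy hEx hEy l.natAbs
  unfold planeHarm
  split_ifs
  exacts [h.1, h.2]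

theorem planeHarm_mul_pow_euler [Algebra ℝ R] (D E : Derivation ℝ R R) {x y : R} (hDx : D x = 1)
    (hDy : D y = 0) (hEx : E x = 0) (hEy : E y = 1) (l : ℤ) (i : ℕ) :
    x * D (planeHarm x y l * (x ^ 2 + y ^ 2) ^ i) + y * E (planeHarm x y l * (x ^ 2 + y ^ 2) ^ i) =
      (l.natAbs + 2 * i) * (planeHarm x y l * (x ^ 2 + y ^ 2) ^ i) := by
  induction i with
  | zero => simpa using planeHarm_euler D E hDx hDy hEx hEy l
  | succ i ih =>
    generalize hf : planeHarm x y l * (x ^ 2 + y ^ 2) ^ i = f at ih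
    have h1 : planeHarm x y l * (x ^ 2 + y ^ 2) ^ (i + 1) = (x ^ 2 + y ^ 2) * f := by
      rw [← hf]; ring
    rw [h1]
    simp only [Derivation.leibniz, map_add, Derivation.leibniz_pow, smul_eq_mul, nsmul_eq_mul, hDx,
      hDy, hEx, hEy]
    push_cast
    linear_combination (x ^ 2 + y ^ 2) * ih

/-- Induction by `Δ(r² f) = r² Δf + 4 (x ∂ₓf + y ∂ᵧf) + 4f` in the plane, with Euler's relation for
the middle term. -/
theorem planeHarm_mul_pow_laplacian [Algebra ℝ R] (D E : Derivation ℝ R R) {x y : R}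
    (hDx : D x = 1) (hDy : D y = 0) (hEx : E x = 0) (hEy : E y = 1) (l : ℤ) (i : ℕ) :
    D (D (planeHarm x y l * (x ^ 2 + y ^ 2) ^ i)) + E (E (planeHarm x y l * (x ^ 2 + y ^ 2) ^ i)) =
      4 * i * (i + l.natAbs) * (planeHarm x y l * (x ^ 2 + y ^ 2) ^ (i - 1)) := by
  induction i with
  | zero => simpa using planeHarm_harmonic D E hDx hDy hEx hEy l
  | succ i ih =>
    have hE := planeHarm_mul_pow_euler D E hDx hDy hEx hEy l i
    -- At `i = 0` the truncated exponent `i - 1` is harmless because of the factor `i`.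
    have h2 : (i : R) * (planeHarm x y l * (x ^ 2 + y ^ 2) ^ (i - 1)) * (x ^ 2 + y ^ 2) =
        i * (planeHarm x y l * (x ^ 2 + y ^ 2) ^ i) := by
      cases i with
      | zero => simp
      | succ i => simp; ring
    simp only [Nat.add_sub_cancel]
    generalize hf : planeHarm x y l * (x ^ 2 + y ^ 2) ^ i = f at ih hE h2 ⊢
    generalize planeHarm x y l * (x ^ 2 + y ^ 2) ^ (i - 1) = g at ih h2
    have h1 : planeHarm x y l * (x ^ 2 + y ^ 2) ^ (i + 1) = (x ^ 2 + y ^ 2) * f := by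
      rw [← hf]; ring
    rw [h1]
    simp only [Derivation.leibniz, map_add, Derivation.leibniz_pow, smul_eq_mul, nsmul_eq_mul, hDx,
      hDy, hEx, hEy, Derivation.map_natCast, Derivation.map_one_eq_zero, map_zero]
    push_cast
    linear_combination (x ^ 2 + y ^ 2) * ih + 4 * hE + 4 * (i + l.natAbs) * h2

theorem derivation_planeHarm_mul_pow_eq_zero [Algebra ℝ R] (D : Derivation ℝ R R) {x y : R}
    (hDx : D x = 0) (hDy : D y = 0) (l : ℤ) (i : ℕ) :
    D (planeHarm x y l * (x ^ 2 + y ^ 2) ^ i) = 0 := by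
  have h : D (planePow x y l.natAbs).1 = 0 ∧ D (planePow x y l.natAbs).2 = 0 := by
    cases l.natAbs with
    | zero => simp [planePow]
    | succ n => simp [derivation_planePow, hDx, hDy]
  have h' : D (planeHarm x y l) = 0 := by
    unfold planeHarm
    split_ifs
    exacts [h.1, h.2]
  simp [Derivation.leibniz, Derivation.leibniz_pow, h', hDx, hDy]

end Algebra

/-! ### Harmonicity and homogeneity of the mode polynomials -/

/-- Apply `C(n, i+1)(i+1) = C(n, i)(n-i)` to each binomial coefficient. With the alternating sign,
this is the cancellation needed for harmonicity. -/
theorem jacobi_coeff_recurrence (a b d i : ℕ) (hi : i < d) :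
    (a + d).choose (i + 1) * (b + d).choose (d - (i + 1)) * ((i + 1) * (i + 1 + b)) =
      (a + d).choose i * (b + d).choose (d - i) * ((d - i) * (d - i + a)) := by
  obtain ⟨j, rfl⟩ : ∃ j, d = i + j + 1 := ⟨d - i - 1, by omega⟩
  have e1 : i + j + 1 - (i + 1) = j := by omega
  have e2 : i + j + 1 - i = j + 1 := by omega
  have h1 := Nat.choose_succ_right_eq (a + (i + j + 1)) i
  have h2 := Nat.choose_succ_right_eq (b + (i + j + 1)) j
  have e3 : a + (i + j + 1) - i = j + 1 + a := by omega
  have e4 : b + (i + j + 1) - j = i + 1 + b := by omega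
  rw [e3] at h1
  rw [e4] at h2
  rw [e1, e2]
  calc _ = ((a + (i + j + 1)).choose (i + 1) * (i + 1)) *
        ((b + (i + j + 1)).choose j * (i + 1 + b)) := by ring
    _ = _ := by rw [h1, ← h2]; ring

/-- The mode as a polynomial in four variables. -/
def modePoly (l m : ℤ) (d : ℕ) : MvPolynomial (Fin 4) ℝ :=
  modeForm l m d (.X 0) (.X 1) (.X 2) (.X 3)

-- Each summand is a function of the first plane times a function of the second, so the Laplacian of
-- `ℝ⁴` splits into two plane Laplacians.
open MvPolynomial in
theorem modePoly_eq_sum (l m : ℤ) (d : ℕ) :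
    modePoly l m d = ∑ i ∈ Finset.range (d + 1),
      (((-1) ^ (d - i) * ((m.natAbs + d).choose i * (l.natAbs + d).choose (d - i) : ℕ) : ℝ)) •
        ((planeHarm (X 0) (X 1) l * (X 0 ^ 2 + X 1 ^ 2) ^ i) *
          (planeHarm (X 2) (X 3) m * (X 2 ^ 2 + X 3 ^ 2) ^ (d - i))) := by
  simp only [modePoly, modeForm, jacobiForm, Finset.mul_sum]
  refine Finset.sum_congr rfl fun i _ => ?_
  rw [smul_eq_C_mul, neg_pow]
  simp
  ring

-- The Laplacian of a summand lowers either the power of `s` or that of `t`. The first contribution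
-- of summand `i + 1` cancels the second contribution of summand `i`.
open MvPolynomial in
theorem modePoly_harmonic (l m : ℤ) (d : ℕ) :
    ∑ j : Fin 4, pderiv j (pderiv j (modePoly l m d)) = 0 := by
  have key (i j : ℕ) : ∑ n : Fin 4, pderiv n (pderiv n
      ((planeHarm (X 0) (X 1) l * (X 0 ^ 2 + X 1 ^ 2) ^ i) *
        (planeHarm (X 2) (X 3) m * (X 2 ^ 2 + X 3 ^ 2) ^ j) : MvPolynomial (Fin 4) ℝ)) =
      ((4 * i * (i + l.natAbs) : ℕ) : MvPolynomial (Fin 4) ℝ) *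
        (planeHarm (X 0) (X 1) l * (X 0 ^ 2 + X 1 ^ 2) ^ (i - 1) *
        (planeHarm (X 2) (X 3) m * (X 2 ^ 2 + X 3 ^ 2) ^ j)) +
      ((4 * j * (j + m.natAbs) : ℕ) : MvPolynomial (Fin 4) ℝ) *
        (planeHarm (X 0) (X 1) l * (X 0 ^ 2 + X 1 ^ 2) ^ i *
        (planeHarm (X 2) (X 3) m * (X 2 ^ 2 + X 3 ^ 2) ^ (j - 1))) := by
    have hu := planeHarm_mul_pow_laplacian (pderiv (R := ℝ) (0 : Fin 4)) (pderiv 1)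
      (x := X 0) (y := X 1) (by simp) (by simp) (by simp) (by simp) l i
    have hv := planeHarm_mul_pow_laplacian (pderiv (R := ℝ) (2 : Fin 4)) (pderiv 3)
      (x := X 2) (y := X 3) (by simp) (by simp) (by simp) (by simp) m j
    have h2 := derivation_planeHarm_mul_pow_eq_zero (pderiv (R := ℝ) (2 : Fin 4))
      (x := X 0) (y := X 1) (by simp) (by simp) l i
    have h3 := derivation_planeHarm_mul_pow_eq_zero (pderiv (R := ℝ) (3 : Fin 4))
      (x := X 0) (y := X 1) (by simp) (by simp) l i
    have h0 := derivation_planeHarm_mul_pow_eq_zero (pderiv (R := ℝ) (0 : Fin 4))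
      (x := X 2) (y := X 3) (by simp) (by simp) m j
    have h1 := derivation_planeHarm_mul_pow_eq_zero (pderiv (R := ℝ) (1 : Fin 4))
      (x := X 2) (y := X 3) (by simp) (by simp) m j
    generalize planeHarm (X 0) (X 1) l * (X 0 ^ 2 + X 1 ^ 2 : MvPolynomial (Fin 4) ℝ) ^ i = u at *
    generalize planeHarm (X 2) (X 3) m * (X 2 ^ 2 + X 3 ^ 2 : MvPolynomial (Fin 4) ℝ) ^ j = v at *
    simp only [Fin.sum_univ_four, Derivation.leibniz, map_add, smul_eq_mul, h0, h1, h2, h3,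
      mul_zero, add_zero, map_zero]
    push_cast
    linear_combination v * hu + u * hv
  rw [modePoly_eq_sum]
  simp only [map_sum, Derivation.map_smul]
  rw [Finset.sum_comm]
  simp only [← Finset.smul_sum, key, smul_add, Finset.sum_add_distrib]
  -- The `i = 0` term of the first sum and the `i = d` term of the second have a zero factor;
  -- removing them aligns the two sums over `range d`.
  rw [Finset.sum_range_succ', add_assoc]
  conv_lhs => enter [2, 2]; rw [Finset.sum_range_succ]
  simp only [Nat.cast_zero, Nat.sub_self, mul_zero, zero_mul, smul_zero, add_zero, zero_add,
    Nat.add_sub_cancel]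
  rw [← Finset.sum_add_distrib]
  refine Finset.sum_eq_zero fun i hi => ?_
  have hi := Finset.mem_range.mp hi
  have h := congrArg (Nat.cast (R := MvPolynomial (Fin 4) ℝ))
    (jacobi_coeff_recurrence m.natAbs l.natAbs d i hi)
  obtain ⟨j, rfl⟩ : ∃ j, d = i + j + 1 := ⟨d - i - 1, by omega⟩
  have e1 : i + j + 1 - (i + 1) = j := by omega
  have e2 : i + j + 1 - i = j + 1 := by omega
  simp only [e1, e2, Nat.add_sub_cancel, smul_eq_C_mul] at h ⊢
  generalize planeHarm (X 0 : MvPolynomial (Fin 4) ℝ) (X 1) l = u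
  generalize planeHarm (X 2 : MvPolynomial (Fin 4) ℝ) (X 3) m = v
  push_cast at h
  simp only [map_mul, map_pow, map_neg, map_one, map_natCast]
  push_cast
  linear_combination (4 * (-1) ^ j * u * v * (X 0 ^ 2 + X 1 ^ 2) ^ i * (X 2 ^ 2 + X 3 ^ 2) ^ j) * h

open MvPolynomial in
theorem modePoly_euler (l m : ℤ) (d : ℕ) :
    ∑ j : Fin 4, X j * pderiv j (modePoly l m d) =
      (l.natAbs + m.natAbs + 2 * d : ℕ) * modePoly l m d := by
  rw [modePoly_eq_sum, Finset.mul_sum]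
  simp only [map_sum, Derivation.map_smul, Finset.mul_sum]
  rw [Finset.sum_comm]
  refine Finset.sum_congr rfl fun i hi => ?_
  simp only [mul_smul_comm, ← Finset.smul_sum]
  congr 1
  obtain ⟨j, rfl⟩ : ∃ j, d = i + j := ⟨d - i, by have := Finset.mem_range.mp hi; omega⟩
  simp only [Nat.add_sub_cancel_left]
  have hu := planeHarm_mul_pow_euler (pderiv (R := ℝ) (0 : Fin 4)) (pderiv 1)
    (x := X 0) (y := X 1) (by simp) (by simp) (by simp) (by simp) l i
  have hv := planeHarm_mul_pow_euler (pderiv (R := ℝ) (2 : Fin 4)) (pderiv 3)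
    (x := X 2) (y := X 3) (by simp) (by simp) (by simp) (by simp) m j
  have h2 := derivation_planeHarm_mul_pow_eq_zero (pderiv (R := ℝ) (2 : Fin 4))
    (x := X 0) (y := X 1) (by simp) (by simp) l i
  have h3 := derivation_planeHarm_mul_pow_eq_zero (pderiv (R := ℝ) (3 : Fin 4))
    (x := X 0) (y := X 1) (by simp) (by simp) l i
  have h0 := derivation_planeHarm_mul_pow_eq_zero (pderiv (R := ℝ) (0 : Fin 4))
    (x := X 2) (y := X 3) (by simp) (by simp) m j
  have h1 := derivation_planeHarm_mul_pow_eq_zero (pderiv (R := ℝ) (1 : Fin 4))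
    (x := X 2) (y := X 3) (by simp) (by simp) m j
  generalize planeHarm (X 0) (X 1) l * (X 0 ^ 2 + X 1 ^ 2 : MvPolynomial (Fin 4) ℝ) ^ i = u at *
  generalize planeHarm (X 2) (X 3) m * (X 2 ^ 2 + X 3 ^ 2 : MvPolynomial (Fin 4) ℝ) ^ j = v at *
  simp only [Fin.sum_univ_four, Derivation.leibniz, smul_eq_mul, h0, h1, h2, h3,
    mul_zero, add_zero, zero_add]
  push_cast
  linear_combination v * hu + u * hv

/-! The modes in toroidal coordinates. -/

theorem planePow_polar (r t : ℝ) (n : ℕ) :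
    planePow (r * Real.cos t) (r * Real.sin t) n =
      (r ^ n * Real.cos (n * t), r ^ n * Real.sin (n * t)) := by
  induction n with
  | zero => simp [planePow]
  | succ n ih =>
    simp only [planePow, ih, Nat.cast_succ, add_mul, one_mul, Real.cos_add, Real.sin_add]
    ext <;> simp <;> ring

theorem planeHarm_polar (r t : ℝ) (l : ℤ) :
    planeHarm (r * Real.cos t) (r * Real.sin t) l = r ^ l.natAbs * circHarmonic l t := by
  unfold planeHarm circHarmonic
  split_ifs <;> simp [planePow_polar]

/-- On `s + t = 1` one has `u + 1 = 2s` and `u - 1 = -2t` for `u = s - t`, so the powers of two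
cancel the factor `1 / 2 ^ d`. -/
theorem jacobiP_eq_jacobiForm (a b d : ℕ) (s t : ℝ) (h : s + t = 1) :
    jacobiP a b d (s - t) = jacobiForm a b d s t := by
  unfold jacobiP jacobiForm
  rw [Finset.mul_sum]
  refine Finset.sum_congr rfl fun i hi => ?_
  obtain ⟨j, rfl⟩ : ∃ j, d = i + j := ⟨d - i, by have := Finset.mem_range.mp hi; omega⟩
  have h1 : s - t + 1 = 2 * s := by linarith
  have h2 : s - t - 1 = 2 * (-t) := by linarith
  rw [h1, h2, Nat.add_sub_cancel_left, mul_pow, mul_pow, pow_add]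
  field_simp

/-- The mode as a polynomial function on the sphere, before normalization. -/
def modeFun (l m : ℤ) (d : ℕ) (p : S3) : ℝ :=
  modeForm l m d ((p : R4) 0) ((p : R4) 1) ((p : R4) 2) ((p : R4) 3)

theorem modeFun_torPoint (k : ℕ) (l m : ℤ) (χ θ φ : ℝ) :
    modeFun l m (modeDeg k l m) (torPoint χ θ φ) = modeTilde k l m χ θ φ := by
  have h1 : Real.cos (2 * χ) = Real.cos χ ^ 2 - Real.sin χ ^ 2 := Real.cos_two_mul' χ
  have h2 : Real.cos χ ^ 2 * Real.cos θ ^ 2 + Real.cos χ ^ 2 * Real.sin θ ^ 2 =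
      Real.cos χ ^ 2 := by
    rw [← mul_add, Real.cos_sq_add_sin_sq, mul_one]
  have h3 : Real.sin χ ^ 2 * Real.cos φ ^ 2 + Real.sin χ ^ 2 * Real.sin φ ^ 2 =
      Real.sin χ ^ 2 := by
    rw [← mul_add, Real.cos_sq_add_sin_sq, mul_one]
  simp only [modeFun, modeForm, modeTilde, torPoint, h1,
    jacobiP_eq_jacobiForm _ _ _ _ _ (Real.cos_sq_add_sin_sq χ)]
  simp [planeHarm_polar, mul_pow, h2, h3]
  ring

theorem S3_sq_sum (p : S3) :
    (p : R4) 0 ^ 2 + (p : R4) 1 ^ 2 + ((p : R4) 2 ^ 2 + (p : R4) 3 ^ 2) = 1 := by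
  have h : ‖(p : R4)‖ = 1 := by simp
  rw [EuclideanSpace.norm_eq, Real.sqrt_eq_one] at h
  simp [Fin.sum_univ_four] at h
  linarith

/-- Where an angle is undefined, the radius multiplying its sine and cosine is zero, so the default
value of `Complex.arg` does no harm. -/
theorem torPoint_coords (p : S3) : torPoint (coordChi p) (coordTheta p) (coordPhi p) = p := by
  have hs := S3_sq_sum p
  set x := (p : R4) 0 with hx
  set y := (p : R4) 1 with hy
  set z := (p : R4) 2 with hz
  set w := (p : R4) 3 with hw
  have hn (a b : ℝ) : ‖(⟨a, b⟩ : ℂ)‖ = Real.sqrt (a ^ 2 + b ^ 2) := by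
    rw [Complex.norm_def, Complex.normSq_apply]; ring_nf
  have hc (a b : ℝ) : Real.sqrt (a ^ 2 + b ^ 2) * Real.cos (Complex.arg ⟨a, b⟩) = a := by
    rw [← hn]; exact Complex.norm_mul_cos_arg _
  have hd (a b : ℝ) : Real.sqrt (a ^ 2 + b ^ 2) * Real.sin (Complex.arg ⟨a, b⟩) = b := by
    rw [← hn]; exact Complex.norm_mul_sin_arg _
  have hcos : Real.cos (coordChi p) = Real.sqrt (x ^ 2 + y ^ 2) := by
    refine Real.cos_arccos ?_ ?_
    · linarith [Real.sqrt_nonneg (x ^ 2 + y ^ 2)]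
    · rw [Real.sqrt_le_one]
      nlinarith [sq_nonneg z, sq_nonneg w]
  have hsin : Real.sin (coordChi p) = Real.sqrt (z ^ 2 + w ^ 2) := by
    rw [coordChi, Real.sin_arccos, Real.sq_sqrt (by positivity)]
    congr 1
    linarith
  apply Subtype.ext
  simp only [torPoint, hcos, hsin, coordTheta, coordPhi, ← hx, ← hy, ← hz, ← hw, hc, hd]
  ext i
  fin_cases i <;> simp [hx, hy, hz, hw]

theorem mode_eq_modeFun (k : ℕ) (l m : ℤ) (p : S3) :
    mode k l m p = modeFun l m (modeDeg k l m) p / modeNorm k l m := by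
  rw [mode, modeCoord, ← modeFun_torPoint, torPoint_coords]

/-- Well-definedness: any coordinates of a point give the value of the same polynomial there, with
no restriction on the range of `χ`. -/
theorem mode_torPoint (k : ℕ) (l m : ℤ) (χ θ φ : ℝ) :
    mode k l m (torPoint χ θ φ) = modeCoord k l m χ θ φ := by
  rw [mode_eq_modeFun, modeFun_torPoint, modeCoord]

theorem modeFun_eq_eval (l m : ℤ) (d : ℕ) (p : S3) :
    modeFun l m d p = MvPolynomial.eval (p : R4) (modePoly l m d) := by
  simp [modeFun, modePoly, map_modeForm]

/-! ### The Laplacian of the sphere on homogeneous polynomials -/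

theorem radialExt_of_ne_zero {F : Type*} [Zero F] (V : S3 → F) {x : R4} (hx : x ≠ 0) :
    radialExt V x = V ⟨‖x‖⁻¹ • x, by
      simp [norm_smul, inv_mul_cancel₀ (norm_ne_zero_iff.mpr hx)]⟩ := by
  simp [radialExt, hx]

/-- The derivative of `x ↦ x / ‖x‖` at a point of the sphere is the tangential projection. -/
theorem hasFDerivAt_normalize (p : S3) :
    HasFDerivAt (fun x : R4 => ‖x‖⁻¹ • x)
      (ContinuousLinearMap.id ℝ R4 - (innerSL ℝ (p : R4)).smulRight (p : R4)) (p : R4) := by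
  have h1 : HasFDerivAt (fun x : R4 => ‖x‖) (innerSL ℝ (p : R4)) (p : R4) := by
    have h := (hasStrictFDerivAt_norm_sq (p : R4)).hasFDerivAt.sqrt (by simp)
    simp only [Real.sqrt_sq (norm_nonneg _)] at h
    refine h.congr_fderiv ?_
    ext v
    simp
  have h2 := (((hasDerivAt_inv (x := ‖(p : R4)‖) (by simp)).comp_hasFDerivAt _ h1).smul
    (hasFDerivAt_id (p : R4)))
  refine h2.congr_fderiv ?_
  ext v
  simp [sub_eq_add_neg]

/-- The derivative of the radial extension, computed from any extension. -/
theorem hasFDerivAt_radialExt {F : Type*} [NormedAddCommGroup F] [NormedSpace ℝ F] {V : S3 → F}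
    {W : R4 → F} (hVW : ∀ q : S3, V q = W q) {p : S3} {W' : R4 →L[ℝ] F}
    (hW : HasFDerivAt W W' (p : R4)) :
    HasFDerivAt (radialExt V)
      (W' ∘L (ContinuousLinearMap.id ℝ R4 - (innerSL ℝ (p : R4)).smulRight (p : R4))) (p : R4) := by
  have hp : (p : R4) = (fun x : R4 => ‖x‖⁻¹ • x) (p : R4) := by simp
  rw [hp] at hW
  refine (HasFDerivAt.comp (f := fun x : R4 => ‖x‖⁻¹ • x) (p : R4) hW
    (hasFDerivAt_normalize p)).congr_of_eventuallyEq ?_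
  filter_upwards [isOpen_ne.mem_nhds (ne_zero_S3 p)] with x hx
  rw [radialExt_of_ne_zero V hx, hVW]
  rfl

section Polynomial

open MvPolynomial

theorem hasFDerivAt_eval (H : MvPolynomial (Fin 4) ℝ) (x : R4) :
    HasFDerivAt (fun x : R4 => eval x H)
      (∑ i, eval x (pderiv i H) • (EuclideanSpace.proj i : R4 →L[ℝ] ℝ)) x := by
  induction H using MvPolynomial.induction_on with
  | C a => simpa using hasFDerivAt_const a x
  | add p q hp hq =>
    simp only [map_add, add_smul, Finset.sum_add_distrib]
    exact hp.add hq
  | mul_X p i hp =>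
    have h := hp.mul (EuclideanSpace.proj i : R4 →L[ℝ] ℝ).hasFDerivAt
    simp only [map_mul, eval_X]
    refine h.congr_fderiv ?_
    ext v
    simp [Derivation.leibniz, pderiv_X, Pi.single_apply, add_mul, Finset.sum_add_distrib,
      Finset.mul_sum, apply_ite (eval x.ofLp)]
    exact Finset.sum_congr rfl fun j _ => by ring

theorem contDiff_eval (H : MvPolynomial (Fin 4) ℝ) : ContDiff ℝ ∞ (fun x : R4 => eval x H) := by
  induction H using MvPolynomial.induction_on with
  | C a => simpa using contDiff_const
  | add p q hp hq => simpa using hp.add hq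
  | mul_X p i hp =>
    simp only [map_mul, eval_X]
    exact hp.mul (EuclideanSpace.proj i : R4 →L[ℝ] ℝ).contDiff

theorem smoothOnS3_eval (H : MvPolynomial (Fin 4) ℝ) :
    SmoothOnS3 (fun p : S3 => eval (p : R4) H) :=
  (contDiff_eval H).contMDiff.comp (contMDiff_coe_sphere (m := ∞))

variable {H : MvPolynomial (Fin 4) ℝ} {k : ℕ}

/-- The coefficients of the tangential gradient of a form of degree `k`. -/
def tangentialGrad (H : MvPolynomial (Fin 4) ℝ) (k : ℕ) (i : Fin 4) : MvPolynomial (Fin 4) ℝ :=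
  pderiv i H - C (k : ℝ) * H * X i

/-- The spherical gradient is the tangential projection `∇H - ⟨p, ∇H⟩ p`, and Euler's relation gives
`⟨p, ∇H⟩ = k H`. -/
theorem sphereGrad_eval (hE : ∑ j, X j * pderiv j H = C (k : ℝ) * H) (p : S3) :
    sphereGrad (fun q : S3 => eval (q : R4) H) p =
      WithLp.toLp 2 fun i => eval (p : R4) (tangentialGrad H k i) := by
  have h := hasFDerivAt_radialExt (V := fun q : S3 => eval (q : R4) H) (fun q => rfl)
    (hasFDerivAt_eval H (p : R4))
  refine HasGradientAt.gradient ?_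
  rw [HasGradientAt]
  refine h.congr_fderiv ?_
  have hE' := congrArg (eval (p : R4)) hE
  simp only [Fin.sum_univ_four, map_add, map_mul, eval_X, eval_C] at hE'
  ext v
  simp [tangentialGrad, PiLp.inner_apply, Fin.sum_univ_four]
  linear_combination (-((p : R4) 0 * v 0 + (p : R4) 1 * v 1 + (p : R4) 2 * v 2 +
    (p : R4) 3 * v 3)) * hE'

/-- For `W = ∇H - k H x` the trace is `div W - ⟨p, DW p⟩`. Euler's relation and `ΔH = 0` give `div W
= -k(k+4) H` and `⟨p, DW p⟩ = -2k H` at `p`. -/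
theorem sphereLaplacian_eval (hE : ∑ j, X j * pderiv j H = C (k : ℝ) * H)
    (hH : ∑ j, pderiv j (pderiv j H) = 0) (p : S3) :
    sphereLaplacian (fun q : S3 => eval (q : R4) H) p =
      -((k : ℝ) * ((k : ℝ) + 2)) * eval (p : R4) H := by
  have hW : HasFDerivAt (fun x : R4 => (WithLp.toLp 2 fun i => eval x (tangentialGrad H k i)))
      ((PiLp.continuousLinearEquiv 2 ℝ (fun _ : Fin 4 => ℝ)).symm.toContinuousLinearMap ∘L
        (ContinuousLinearMap.pi fun i => ∑ j, eval (p : R4) (pderiv j (tangentialGrad H k i)) •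
          (EuclideanSpace.proj j : R4 →L[ℝ] ℝ))) (p : R4) := by
    have h := hasFDerivAt_pi.mpr fun i => hasFDerivAt_eval (tangentialGrad H k i) (p : R4)
    exact (PiLp.continuousLinearEquiv 2 ℝ (fun _ : Fin 4 => ℝ)).symm.hasFDerivAt.comp _ h
  have h := hasFDerivAt_radialExt (V := sphereGrad fun q : S3 => eval (q : R4) H)
    (sphereGrad_eval hE) hW
  rw [sphereLaplacian, sphereDiv, h.fderiv,
    LinearMap.trace_eq_sum_inner _ (EuclideanSpace.basisFun (Fin 4) ℝ)]
  have hE0 := congrArg (eval (p : R4)) hE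
  -- The differentiated Euler relation expresses the Hessian of `H` applied to `p` through first
  -- derivatives.
  have hE1 (i : Fin 4) := congrArg (eval (p : R4)) (congrArg (pderiv i) hE)
  have hH0 := congrArg (eval (p : R4)) hH
  have hp := S3_sq_sum p
  simp only [Fin.sum_univ_four, map_add, map_mul, eval_X, eval_C, Derivation.leibniz, smul_eq_mul,
    pderiv_C, map_zero] at hE0 hE1 hH0
  have h0 := hE1 0
  have h1 := hE1 1
  have h2 := hE1 2
  have h3 := hE1 3
  simp [pderiv_X] at h0 h1 h2 h3
  simp [tangentialGrad, PiLp.inner_apply, Fin.sum_univ_four, pderiv_X]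
  generalize (p : R4) 0 = x at *
  generalize (p : R4) 1 = y at *
  generalize (p : R4) 2 = z at *
  generalize (p : R4) 3 = w at *
  linear_combination hH0 - x * h0 - y * h1 - z * h2 - w * h3 + (1 - (k : ℝ)) * hE0 +
    ((k : ℝ) * eval (p : R4) H + k * (x * eval (p : R4) (pderiv 0 H) +
      y * eval (p : R4) (pderiv 1 H) + z * eval (p : R4) (pderiv 2 H) +
      w * eval (p : R4) (pderiv 3 H))) * hp

theorem smoothOnS3_modeFun (l m : ℤ) (d : ℕ) : SmoothOnS3 (modeFun l m d) := by
  simpa only [← modeFun_eq_eval] using smoothOnS3_eval (modePoly l m d)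

theorem sphereLaplacian_modeFun (l m : ℤ) (d : ℕ) (p : S3) :
    sphereLaplacian (modeFun l m d) p =
      -(((l.natAbs + m.natAbs + 2 * d : ℕ) : ℝ) * (((l.natAbs + m.natAbs + 2 * d : ℕ) : ℝ) + 2)) *
        modeFun l m d p := by
  have h := sphereLaplacian_eval (k := l.natAbs + m.natAbs + 2 * d)
    (by rw [modePoly_euler, map_natCast]) (modePoly_harmonic l m d) p
  simpa only [← modeFun_eq_eval] using h

end Polynomial

open MeasureTheory

/-! ### Polar coordinates and homogeneity of radial extensions -/

/-- Transfers integrals between the sphere and `ℝ⁴`. The radial weight is a bump in Green's identity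
and a Gaussian in the moments. -/
theorem integral_norm_mul_radialExt (a : ℝ → ℝ) (h : S3 → ℝ) :
    ∫ x : R4, a ‖x‖ * radialExt h x =
      (∫ r : Set.Ioi (0 : ℝ), a r ∂(Measure.volumeIoiPow 3)) *
        ∫ p : S3, h p ∂((volume : Measure R4).toSphere) :=
  calc
    ∫ x : R4, a ‖x‖ * radialExt h x =
        ∫ x : ({0}ᶜ : Set R4), a ‖(x : R4)‖ * radialExt h x
          ∂(Measure.comap Subtype.val volume) := by
      rw [integral_subtype_comap (measurableSet_singleton _).compl
        fun x : R4 => a ‖x‖ * radialExt h x, restrict_compl_singleton]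
    _ = ∫ y : S3 × Set.Ioi (0 : ℝ), h y.1 * a y.2
          ∂((volume : Measure R4).toSphere.prod (.volumeIoiPow 3)) := by
      have hd : Module.finrank ℝ R4 - 1 = 3 := by simp
      rw [← hd, ← (volume : Measure R4).measurePreserving_homeomorphUnitSphereProd.integral_comp
        (Homeomorph.measurableEmbedding _) fun y => h y.1 * a y.2]
      refine integral_congr_ae (.of_forall fun x => ?_)
      have hx : (x : R4) ≠ 0 := x.2
      simp only [radialExt_of_ne_zero h hx, homeomorphUnitSphereProd_apply_snd_coe]
      rw [mul_comm]
      congr 2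
      apply Subtype.ext
      simp
    _ = _ := by rw [integral_prod_mul h fun r : Set.Ioi (0 : ℝ) => a r, mul_comm]

theorem radialExt_smul_pos {F : Type*} [Zero F] (V : S3 → F) {c : ℝ} (hc : 0 < c) (x : R4) :
    radialExt V (c • x) = radialExt V x := by
  by_cases hx : x = 0
  · simp [hx]
  · rw [radialExt_of_ne_zero V hx, radialExt_of_ne_zero V (smul_ne_zero hc.ne' hx)]
    congr 2
    rw [norm_smul, smul_smul, Real.norm_of_nonneg hc.le]
    congr 1
    field_simp

/-- The derivative of a function homogeneous of degree `0` is homogeneous of degree `-1`. -/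
theorem fderiv_radialExt_smul {F : Type*} [NormedAddCommGroup F] [NormedSpace ℝ F] (V : S3 → F)
    {c : ℝ} (hc : 0 < c) (x : R4) :
    fderiv ℝ (radialExt V) (c • x) = c⁻¹ • fderiv ℝ (radialExt V) x := by
  have h := fderiv_comp_smul (𝕜 := ℝ) (f := radialExt V) (x := x) c
  simp only [radialExt_smul_pos V hc] at h
  rw [h, smul_smul, inv_mul_cancel₀ hc.ne', one_smul]

theorem fderiv_radialExt_self {f : S3 → ℝ} (hf : SmoothOnS3 f) {x : R4} (hx : x ≠ 0) :
    fderiv ℝ (radialExt f) x x = 0 := by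
  have hd : HasFDerivAt (radialExt f) (fderiv ℝ (radialExt f) x) ((fun t : ℝ => t • x) 1) := by
    simpa using ((contDiffAt_radialExt hf hx).differentiableAt (by simp)).hasFDerivAt
  have h1 : HasDerivAt (fun t : ℝ => t • x) x 1 := by
    simpa using (hasDerivAt_id (1 : ℝ)).smul_const x
  have h2 := hd.comp_hasDerivAt (1 : ℝ) h1
  have h3 : HasDerivAt (radialExt f ∘ fun t : ℝ => t • x) 0 1 := by
    refine (hasDerivAt_const (1 : ℝ) (radialExt f x)).congr_of_eventuallyEq ?_
    filter_upwards [lt_mem_nhds (zero_lt_one (α := ℝ))] with t ht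
    exact radialExt_smul_pos f ht x
  exact h2.unique h3

theorem radialExt_sphereGrad (f : S3 → ℝ) {x : R4} (hx : x ≠ 0) :
    radialExt (sphereGrad f) x = ‖x‖ • gradient (radialExt f) x := by
  have hn : 0 < ‖x‖⁻¹ := inv_pos.mpr (norm_pos_iff.mpr hx)
  rw [radialExt_of_ne_zero _ hx, sphereGrad, gradient, gradient, fderiv_radialExt_smul f hn]
  simp

theorem trace_fderiv_radialExt_sphereGrad (f : S3 → ℝ) {x : R4} (hx : x ≠ 0) :
    ‖x‖ * LinearMap.trace ℝ R4 (fderiv ℝ (radialExt (sphereGrad f)) x : R4 →ₗ[ℝ] R4) =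
      radialExt (sphereLaplacian f) x := by
  have hn : 0 < ‖x‖⁻¹ := inv_pos.mpr (norm_pos_iff.mpr hx)
  rw [radialExt_of_ne_zero _ hx, sphereLaplacian, sphereDiv, fderiv_radialExt_smul _ hn]
  simp

theorem contDiffAt_radialExt_sphereGrad {f : S3 → ℝ} (hf : SmoothOnS3 f) {x : R4} (hx : x ≠ 0) :
    ContDiffAt ℝ 1 (radialExt (sphereGrad f)) x := by
  have hG : ContDiffAt ℝ 1 (fun y : R4 => gradient (radialExt f) y) x := by
    have h := (contDiffAt_radialExt hf hx).fderiv_right (m := 1) (by norm_cast)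
    exact ((InnerProductSpace.toDual ℝ R4).symm.toContinuousLinearEquiv.contDiff.contDiffAt).comp
      x h
  refine ((contDiffAt_norm ℝ hx).smul hG).congr_of_eventuallyEq ?_
  filter_upwards [isOpen_ne.mem_nhds hx] with y hy
  exact radialExt_sphereGrad f hy

/-! ### Symmetry of the Laplacian -/

theorem integral_fderiv_eq_zero {h : R4 → ℝ} (hh : ContDiff ℝ 1 h) (hc : HasCompactSupport h)
    (v : R4) : ∫ x, fderiv ℝ h x v = 0 := by
  have h1 : Integrable (fun x => fderiv ℝ h x v) :=
    ((hh.continuous_fderiv one_ne_zero).clm_apply continuous_const).integrable_of_hasCompactSupport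
      (hc.fderiv_apply ℝ v)
  have h2 := integral_mul_fderiv_eq_neg_fderiv_mul_of_integrable (μ := (volume : Measure R4))
    (f := fun _ => (1 : ℝ)) (g := h) (v := v) (by simp) (by simpa using h1)
    (by simpa using hh.continuous.integrable_of_hasCompactSupport hc)
    (fun x _ => differentiableAt_const _) (fun x _ => (hh.differentiable one_ne_zero) x)
  simpa using h2

section Green

variable {A : ℝ → ℝ} {f g : S3 → ℝ}

/-- Radial extensions are singular only at the origin, and the cutoff vanishes near it. -/
theorem contDiff_cutoff_mul {n : WithTop ℕ∞} {u : R4 → ℝ} (hA : ContDiff ℝ n A)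
    (h0 : ∀ s < 1, A s = 0) (hu : ∀ x : R4, x ≠ 0 → ContDiffAt ℝ n u x) :
    ContDiff ℝ n fun x : R4 => A (‖x‖ ^ 2) * u x := by
  rw [contDiff_iff_contDiffAt]
  intro x
  by_cases hx : x = 0
  · refine (contDiffAt_const (c := (0 : ℝ))).congr_of_eventuallyEq ?_
    filter_upwards [Metric.ball_mem_nhds x one_pos] with y hy
    have : ‖y‖ < 1 := by simpa [hx] using hy
    rw [h0 _ (by nlinarith [norm_nonneg y]), zero_mul]
  · exact (hA.comp (contDiff_norm_sq ℝ)).contDiffAt.mul (hu x hx)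

theorem hasCompactSupport_cutoff_mul (h3 : ∀ s, 3 < s → A s = 0) (u : R4 → ℝ) :
    HasCompactSupport fun x : R4 => A (‖x‖ ^ 2) * u x := by
  refine HasCompactSupport.of_support_subset_isCompact (isCompact_closedBall (0 : R4) 2) ?_
  intro x hx
  by_contra hx'
  have : 2 < ‖x‖ := by simpa using hx'
  exact hx (by simp only [h3 (‖x‖ ^ 2) (by nlinarith), zero_mul])

/-- The divergence of the compactly supported field `A(‖x‖²) f V` integrates to zero.
Differentiating the cutoff contributes a multiple of `⟨x, V⟩`, which vanishes because `V` is tangent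
to the spheres about the origin. -/
theorem integral_cutoff_green (hA : ContDiff ℝ 1 A) (h0 : ∀ s < 1, A s = 0)
    (h3 : ∀ s, 3 < s → A s = 0) (hf : SmoothOnS3 f) (hg : SmoothOnS3 g) :
    ∫ x : R4, A (‖x‖ ^ 2) * (radialExt f x *
        LinearMap.trace ℝ R4 (fderiv ℝ (radialExt (sphereGrad g)) x : R4 →ₗ[ℝ] R4)) =
      -∫ x : R4, A (‖x‖ ^ 2) * (‖x‖ *
        inner ℝ (gradient (radialExt f) x) (gradient (radialExt g) x)) := by
  set V := radialExt (sphereGrad g) with hV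
  have hVi (i : Fin 4) {x : R4} (hx : x ≠ 0) : ContDiffAt ℝ 1 (fun x => V x i) x :=
    (EuclideanSpace.proj i : R4 →L[ℝ] ℝ).contDiff.contDiffAt.comp x
      (contDiffAt_radialExt_sphereGrad hg hx)
  have hF {x : R4} (hx : x ≠ 0) : ContDiffAt ℝ 1 (radialExt f) x :=
    (contDiffAt_radialExt hf hx).of_le (by norm_cast)
  have hh (i : Fin 4) : ContDiff ℝ 1 fun x : R4 => A (‖x‖ ^ 2) * (radialExt f x * V x i) :=
    contDiff_cutoff_mul hA h0 fun x hx => (hF hx).mul (hVi i hx)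
  have hc (i : Fin 4) : HasCompactSupport fun x : R4 => A (‖x‖ ^ 2) * (radialExt f x * V x i) :=
    hasCompactSupport_cutoff_mul h3 _
  have hpt (x : R4) : A (‖x‖ ^ 2) * (radialExt f x *
        LinearMap.trace ℝ R4 (fderiv ℝ V x : R4 →ₗ[ℝ] R4)) + A (‖x‖ ^ 2) * (‖x‖ *
        inner ℝ (gradient (radialExt f) x) (gradient (radialExt g) x)) =
      ∑ i, fderiv ℝ (fun x : R4 => A (‖x‖ ^ 2) * (radialExt f x * V x i)) x
        (EuclideanSpace.single i 1) := by
    by_cases hx : x = 0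
    · subst hx
      have hz (i : Fin 4) :
          fderiv ℝ (fun x : R4 => A (‖x‖ ^ 2) * (radialExt f x * V x i)) 0 = 0 := by
        have : (fun x : R4 => A (‖x‖ ^ 2) * (radialExt f x * V x i)) =ᶠ[nhds 0] fun _ => 0 := by
          filter_upwards [Metric.ball_mem_nhds (0 : R4) one_pos] with y hy
          have : ‖y‖ < 1 := by simpa using hy
          rw [h0 _ (by nlinarith [norm_nonneg y]), zero_mul]
        rw [this.fderiv_eq]
        simp
      simp [hz, h0]
    · have e1 : HasFDerivAt (fun x : R4 => A (‖x‖ ^ 2))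
          (deriv A (‖x‖ ^ 2) • (2 • innerSL ℝ x)) x :=
        ((hA.differentiable one_ne_zero).differentiableAt.hasDerivAt).comp_hasFDerivAt x
          (hasStrictFDerivAt_norm_sq x).hasFDerivAt
      have e2 := ((hF hx).differentiableAt one_ne_zero).hasFDerivAt
      have e3 (i : Fin 4) : HasFDerivAt (fun x => V x i)
          ((EuclideanSpace.proj i : R4 →L[ℝ] ℝ) ∘L fderiv ℝ V x) x :=
        (EuclideanSpace.proj i : R4 →L[ℝ] ℝ).hasFDerivAt.comp x
          ((contDiffAt_radialExt_sphereGrad hg hx).differentiableAt one_ne_zero).hasFDerivAt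
      have e4 : inner ℝ x (V x) = 0 := by
        rw [hV, radialExt_sphereGrad g hx, inner_smul_right, real_inner_comm,
          inner_gradient_left, fderiv_radialExt_self hg hx, mul_zero]
      have e5 : ‖x‖ * inner ℝ (gradient (radialExt f) x) (gradient (radialExt g) x) =
          fderiv ℝ (radialExt f) x (V x) := by
        rw [hV, radialExt_sphereGrad g hx, map_smul, inner_gradient_left, smul_eq_mul]
      have e6 : V x = ∑ i, V x i • (EuclideanSpace.single i 1 : R4) := by
        ext j
        simp [Pi.single_apply]
      rw [e5]
      conv_lhs => enter [2, 2]; rw [e6]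
      have e7 (i : Fin 4) : HasFDerivAt (fun x : R4 => A (‖x‖ ^ 2) * (radialExt f x * V x i)) _ x :=
        e1.mul (e2.mul (e3 i))
      simp only [fun i => (e7 i).fderiv]
      rw [LinearMap.trace_eq_sum_inner _ (EuclideanSpace.basisFun (Fin 4) ℝ)]
      rw [PiLp.inner_apply] at e4
      simp [Fin.sum_univ_four, EuclideanSpace.inner_single_left,
        EuclideanSpace.inner_single_right] at e4 ⊢
      linear_combination (-2 * radialExt f x * deriv A (‖x‖ ^ 2)) * e4
  have hi (i : Fin 4) : Integrable fun x => fderiv ℝ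
      (fun x : R4 => A (‖x‖ ^ 2) * (radialExt f x * V x i)) x (EuclideanSpace.single i 1) :=
    (((hh i).continuous_fderiv one_ne_zero).clm_apply
      continuous_const).integrable_of_hasCompactSupport ((hc i).fderiv_apply ℝ _)
  have hb : Integrable fun x : R4 => A (‖x‖ ^ 2) * (‖x‖ *
      inner ℝ (gradient (radialExt f) x) (gradient (radialExt g) x)) := by
    refine Continuous.integrable_of_hasCompactSupport ?_ (hasCompactSupport_cutoff_mul h3 _)
    refine (contDiff_cutoff_mul (n := 0) (hA.of_le zero_le_one) h0 fun x hx => ?_).continuous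
    have hgr {f : S3 → ℝ} (hf : SmoothOnS3 f) :
        ContDiffAt ℝ 0 (fun y : R4 => gradient (radialExt f) y) x :=
      ((InnerProductSpace.toDual ℝ R4).symm.toContinuousLinearEquiv.contDiff.contDiffAt).comp
        x ((contDiffAt_radialExt hf hx).fderiv_right (m := 0) (by norm_cast))
    exact (contDiffAt_norm ℝ hx).mul ((hgr hf).inner ℝ (hgr hg))
  simp only [fun x => eq_sub_of_add_eq (hpt x)]
  rw [integral_sub (integrable_finsetSum _ fun i _ => hi i) hb,
    integral_finsetSum _ fun i _ => hi i]
  simp [fun i => integral_fderiv_eq_zero (hh i) (hc i)]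

end Green

/-- The Laplacian is symmetric on smooth functions. -/
theorem sphereInner_sphereLaplacian_comm {f g : S3 → ℝ} (hf : SmoothOnS3 f) (hg : SmoothOnS3 g) :
    sphereInner f (sphereLaplacian g) = sphereInner (sphereLaplacian f) g := by
  -- A bump in the variable `s = ‖x‖²`, vanishing outside `1 < s < 3`.
  let b : ContDiffBump (2 : ℝ) := ⟨1 / 2, 1, by norm_num, by norm_num⟩
  have hb {s : ℝ} (hs : 1 ≤ |s - 2|) : b s = 0 :=
    b.zero_of_le_dist (by simpa [Real.dist_eq] using hs)
  have hb1 {s : ℝ} (hs : s ≤ 1) : b s = 0 := hb (by rw [abs_of_nonpos] <;> linarith)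
  have hb3 {s : ℝ} (hs : 3 ≤ s) : b s = 0 := hb (by rw [abs_of_nonneg] <;> linarith)
  -- The factor `√s = ‖x‖` turns the trace, homogeneous of degree `-1`, into the radial extension of
  -- the Laplacian.
  have hA : ContDiff ℝ 1 fun s => Real.sqrt s * b s := by
    rw [contDiff_iff_contDiffAt]
    intro s
    by_cases hs : s = 0
    · refine (contDiffAt_const (c := (0 : ℝ))).congr_of_eventuallyEq ?_
      filter_upwards [gt_mem_nhds (show s < 1 by simp [hs])] with t ht
      rw [hb1 ht.le, mul_zero]
    · exact (Real.contDiffAt_sqrt hs).mul b.contDiffAt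
  have key {f g : S3 → ℝ} (hf : SmoothOnS3 f) (hg : SmoothOnS3 g) :=
    integral_cutoff_green hA (fun s hs => by rw [hb1 hs.le, mul_zero])
      (fun s hs => by rw [hb3 hs.le, mul_zero]) hf hg
  have hpolar (f g : S3 → ℝ) :
      ∫ x : R4, Real.sqrt (‖x‖ ^ 2) * b (‖x‖ ^ 2) * (radialExt f x *
        LinearMap.trace ℝ R4 (fderiv ℝ (radialExt (sphereGrad g)) x : R4 →ₗ[ℝ] R4)) =
      (∫ r : Set.Ioi (0 : ℝ), b (r ^ 2) ∂(Measure.volumeIoiPow 3)) *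
        sphereInner f (sphereLaplacian g) := by
    rw [sphereInner, ← integral_norm_mul_radialExt fun r => b (r ^ 2)]
    refine integral_congr_ae (.of_forall fun x => ?_)
    by_cases hx : x = 0
    · simp [hx, hb1]
    · have h := trace_fderiv_radialExt_sphereGrad g hx
      simp only [Real.sqrt_sq (norm_nonneg x)]
      have h' : radialExt (fun p => f p * sphereLaplacian g p) x =
          radialExt f x * radialExt (sphereLaplacian g) x := by
        simp only [radialExt_of_ne_zero _ hx]
      rw [h', ← h]
      ring
  -- If this radial mass were zero, the integral over `ℝ⁴` of the nonnegative function `b(‖x‖²)`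
  -- would be zero, though it equals `1` where `‖x‖² = 2`.
  have hpos : (∫ r : Set.Ioi (0 : ℝ), b (r ^ 2) ∂(Measure.volumeIoiPow 3)) ≠ 0 := by
    intro h
    have h1 := integral_norm_mul_radialExt (fun r => b (r ^ 2)) fun _ => 1
    rw [h, zero_mul] at h1
    have h2 (x : R4) : b (‖x‖ ^ 2) * radialExt (fun _ => (1 : ℝ)) x = b (‖x‖ ^ 2) * 1 := by
      by_cases hx : x = 0
      · simp [hx, hb1]
      · rw [radialExt_of_ne_zero _ hx]
    simp only [h2] at h1
    refine h1.not_gt (Continuous.integral_pos_of_hasCompactSupport_nonneg_nonzero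
      (x := Real.sqrt 2 • EuclideanSpace.single 0 1) ?_ ?_ ?_ ?_)
    · exact (b.continuous.comp (continuous_norm.pow 2)).mul continuous_const
    · exact hasCompactSupport_cutoff_mul (fun s hs => hb3 hs.le) _
    · intro x
      simpa using b.nonneg
    · simp [norm_smul, b.one_of_mem_closedBall (Metric.mem_closedBall_self b.rIn_pos.le)]
  -- The gradient side of Green's identity is symmetric in `f` and `g`, so the two Laplacian sides
  -- agree.
  have h1 := key hf hg
  have h2 := key hg hf
  rw [hpolar] at h1 h2
  simp only [fun x => real_inner_comm (gradient (radialExt g) x) (gradient (radialExt f) x)] at h1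
  have h3 := mul_left_cancel₀ hpos (h1.trans h2.symm)
  rw [h3, sphereInner, sphereInner]
  simp only [mul_comm]

/-! ### Gaussian integrals over the plane -/

/-- Fubini, after identifying `ℝ⁴` with `ℝ² × ℝ²` by measure-preserving rearrangements of
coordinates. -/
theorem integral_R4_mul (u v : ℝ × ℝ → ℝ) :
    ∫ x : R4, u (x 0, x 1) * v (x 2, x 3) = (∫ a, u a) * ∫ b, v b := by
  let e := (MeasurableEquiv.piCongrLeft (fun _ : Fin 4 => ℝ)
    (finSumFinEquiv (m := 2) (n := 2))).symm
  have he : MeasurePreserving e volume volume :=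
    (volume_measurePreserving_piCongrLeft (fun _ : Fin 4 => ℝ)
      (finSumFinEquiv (m := 2) (n := 2))).symm
  let s := MeasurableEquiv.sumPiEquivProdPi (fun _ : Fin 2 ⊕ Fin 2 => ℝ)
  have hs : MeasurePreserving s volume volume := volume_measurePreserving_sumPiEquivProdPi _
  have ht := volume_preserving_finTwoArrow ℝ
  have h := (((ht.prod ht).comp hs).comp he).comp (PiLp.volume_preserving_ofLp (Fin 4))
  have hemb : MeasurableEmbedding (Prod.map (MeasurableEquiv.finTwoArrow (α := ℝ))
      (MeasurableEquiv.finTwoArrow (α := ℝ))) :=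
    (MeasurableEquiv.prodCongr MeasurableEquiv.finTwoArrow
      MeasurableEquiv.finTwoArrow).measurableEmbedding
  have h' := h.integral_comp (((hemb.comp s.measurableEmbedding).comp e.measurableEmbedding).comp
    (MeasurableEquiv.toLp 2 (Fin 4 → ℝ)).symm.measurableEmbedding) fun y => u y.1 * v y.2
  rw [integral_prod_mul] at h'
  exact h'

theorem integral_pow_mul_exp_neg_sq (n : ℕ) :
    ∫ r in Set.Ioi (0 : ℝ), r ^ n * Real.exp (-r ^ 2) =
      1 / 2 * Real.Gamma (((n : ℝ) + 1) / 2) := by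
  have h := integral_rpow_mul_exp_neg_rpow (p := 2) (q := n) two_pos
    (by linarith [(Nat.cast_nonneg n : (0 : ℝ) ≤ n)])
  simpa using h

theorem integral_volumeIoiPow_pow_mul_exp_neg_sq (n : ℕ) :
    ∫ r : Set.Ioi (0 : ℝ), (r : ℝ) ^ n * Real.exp (-(r : ℝ) ^ 2) ∂(Measure.volumeIoiPow 3) =
      1 / 2 * Real.Gamma (((n : ℝ) + 4) / 2) := by
  have h := integral_pow_mul_exp_neg_sq (n + 3)
  simp only [Measure.volumeIoiPow, ENNReal.ofReal]
  rw [integral_withDensity_eq_integral_smul (measurable_subtype_coe.pow_const _).real_toNNReal,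
    integral_subtype_comap measurableSet_Ioi
      fun r : ℝ => Real.toNNReal (r ^ 3) • (r ^ n * Real.exp (-r ^ 2)),
    setIntegral_congr_fun (g := fun r : ℝ => r ^ (n + 3) * Real.exp (-r ^ 2)) measurableSet_Ioi
      fun r hr => ?_, h]
  · push_cast
    ring_nf
  · simp only [NNReal.smul_def, Real.coe_toNNReal _ (pow_nonneg (le_of_lt hr) _), smul_eq_mul]
    ring

theorem integral_cos_int_mul (n : ℤ) :
    ∫ t in (-Real.pi)..Real.pi, Real.cos (n * t) = if n = 0 then 2 * Real.pi else 0 := by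
  split_ifs with h
  · simp [h]; ring
  · have : (n : ℝ) ≠ 0 := by exact_mod_cast h
    rw [intervalIntegral.integral_comp_mul_left _ this]
    simp [Real.sin_int_mul_pi]

theorem integral_sin_int_mul (n : ℤ) :
    ∫ t in (-Real.pi)..Real.pi, Real.sin (n * t) = 0 := by
  by_cases h : n = 0
  · simp [h]
  · have : (n : ℝ) ≠ 0 := by exact_mod_cast h
    rw [intervalIntegral.integral_comp_mul_left _ this]
    simp

theorem integral_cos_mul_cos (a b : ℕ) :
    ∫ t in (-Real.pi)..Real.pi, Real.cos (a * t) * Real.cos (b * t) =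
      if a = b then 2 ^ hat a * Real.pi else 0 := by
  have h (t : ℝ) : Real.cos (a * t) * Real.cos (b * t) =
      1 / 2 * (Real.cos (((a - b : ℤ) : ℝ) * t) + Real.cos (((a + b : ℤ) : ℝ) * t)) := by
    simp only [Int.cast_sub, Int.cast_add, Int.cast_natCast, sub_mul, add_mul, Real.cos_sub,
      Real.cos_add]
    ring
  have hc (n : ℤ) : IntervalIntegrable (fun t : ℝ => Real.cos (n * t)) volume
      (-Real.pi) Real.pi := Continuous.intervalIntegrable (by fun_prop) _ _
  simp only [h]
  rw [intervalIntegral.integral_const_mul, intervalIntegral.integral_add (hc _) (hc _),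
    integral_cos_int_mul, integral_cos_int_mul]
  by_cases hab : a = b
  · subst hab
    by_cases h0 : a = 0
    · simp [h0, hat]; ring
    · simp [h0, hat]
  · rw [if_neg (by omega), if_neg (by omega), if_neg hab]
    simp

/-- The condition `a ≠ 0` excludes `a = b = 0`, where the integral is `0` and not `π`. -/
theorem integral_sin_mul_sin (a b : ℕ) (ha : a ≠ 0) :
    ∫ t in (-Real.pi)..Real.pi, Real.sin (a * t) * Real.sin (b * t) =
      if a = b then Real.pi else 0 := by
  have h (t : ℝ) : Real.sin (a * t) * Real.sin (b * t) =
      1 / 2 * (Real.cos (((a - b : ℤ) : ℝ) * t) - Real.cos (((a + b : ℤ) : ℝ) * t)) := by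
    simp only [Int.cast_sub, Int.cast_add, Int.cast_natCast, sub_mul, add_mul, Real.cos_sub,
      Real.cos_add]
    ring
  have hc (n : ℤ) : IntervalIntegrable (fun t : ℝ => Real.cos (n * t)) volume
      (-Real.pi) Real.pi := Continuous.intervalIntegrable (by fun_prop) _ _
  simp only [h]
  rw [intervalIntegral.integral_const_mul, intervalIntegral.integral_sub (hc _) (hc _),
    integral_cos_int_mul, integral_cos_int_mul, if_neg (show (a + b : ℤ) ≠ 0 by omega)]
  by_cases hab : a = b
  · simp [hab]
  · rw [if_neg (by omega), if_neg hab]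
    simp

theorem integral_sin_mul_cos (a b : ℕ) :
    ∫ t in (-Real.pi)..Real.pi, Real.sin (a * t) * Real.cos (b * t) = 0 := by
  have h (t : ℝ) : Real.sin (a * t) * Real.cos (b * t) =
      1 / 2 * (Real.sin (((a - b : ℤ) : ℝ) * t) + Real.sin (((a + b : ℤ) : ℝ) * t)) := by
    simp only [Int.cast_sub, Int.cast_add, Int.cast_natCast, sub_mul, add_mul, Real.sin_sub,
      Real.sin_add]
    ring
  have hc (n : ℤ) : IntervalIntegrable (fun t : ℝ => Real.sin (n * t)) volume
      (-Real.pi) Real.pi := Continuous.intervalIntegrable (by fun_prop) _ _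
  simp only [h]
  rw [intervalIntegral.integral_const_mul, intervalIntegral.integral_add (hc _) (hc _),
    integral_sin_int_mul, integral_sin_int_mul]
  simp

theorem integral_circHarmonic_mul (l l' : ℤ) :
    ∫ t in Set.Ioo (-Real.pi) Real.pi, circHarmonic l t * circHarmonic l' t =
      if l = l' then 2 ^ hat l * Real.pi else 0 := by
  have hpi : -Real.pi ≤ Real.pi := by linarith [Real.pi_pos]
  rw [← integral_Ioc_eq_integral_Ioo, ← intervalIntegral.integral_of_le hpi]
  unfold circHarmonic
  rcases le_or_gt 0 l with h | h <;> rcases le_or_gt 0 l' with h' | h'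
  · simp only [if_pos h, if_pos h', integral_cos_mul_cos, Int.natAbs_of_nonneg h]
    exact if_congr (by omega) rfl rfl
  · simp only [if_pos h, if_neg h'.not_ge, mul_comm (Real.cos _), integral_sin_mul_cos]
    rw [if_neg (by omega)]
  · simp only [if_neg h.not_ge, if_pos h', integral_sin_mul_cos]
    rw [if_neg (by omega)]
  · simp only [if_neg h.not_ge, if_neg h'.not_ge]
    rw [integral_sin_mul_sin _ _ (by omega), hat, if_neg h.ne, pow_zero, one_mul]
    exact if_congr (by omega) rfl rfl

/-- The product of two plane harmonics with a power of the squared radius. -/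
def planeMoment (l l' : ℤ) (i : ℕ) (x y : ℝ) : ℝ :=
  planeHarm x y l * planeHarm x y l' * (x ^ 2 + y ^ 2) ^ i

theorem planeMoment_mul (l l' : ℤ) (i : ℕ) (c x y : ℝ) :
    planeMoment l l' i (c * x) (c * y) =
      c ^ (l.natAbs + l'.natAbs + 2 * i) * planeMoment l l' i x y := by
  simp only [planeMoment, planeHarm_mul]
  rw [mul_pow, mul_pow, ← mul_add, mul_pow, pow_add, pow_add, pow_mul]
  ring

theorem integral_planeMoment_mul_exp (l l' : ℤ) (i : ℕ) :
    ∫ a : ℝ × ℝ, planeMoment l l' i a.1 a.2 * Real.exp (-(a.1 ^ 2 + a.2 ^ 2)) =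
      (1 / 2 * Real.Gamma (((l.natAbs + l'.natAbs + 2 * i + 1 : ℕ) + 1 : ℝ) / 2)) *
        if l = l' then 2 ^ hat l * Real.pi else 0 := by
  rw [← integral_circHarmonic_mul, ← integral_pow_mul_exp_neg_sq, ← setIntegral_prod_mul,
    ← integral_comp_polarCoord_symm]
  refine setIntegral_congr_fun (measurableSet_Ioi.prod measurableSet_Ioo) fun a _ => ?_
  obtain ⟨r, t⟩ := a
  have h1 : (r * Real.cos t) ^ 2 + (r * Real.sin t) ^ 2 = r ^ 2 := by
    rw [mul_pow, mul_pow, ← mul_add, Real.cos_sq_add_sin_sq, mul_one]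
  change r * (planeMoment l l' i (r * Real.cos t) (r * Real.sin t) *
    Real.exp (-((r * Real.cos t) ^ 2 + (r * Real.sin t) ^ 2))) = _
  rw [h1]
  simp only [planeMoment, planeHarm_polar, h1]
  rw [pow_succ, pow_add, pow_add, pow_mul]
  ring

/-! ### Moments of the sphere -/

/-- The integrand of a moment: a product of plane harmonics in each of the two planes, with powers
of the squared radii. -/
def sphereMoment (l l' m m' : ℤ) (i j : ℕ) (p : S3) : ℝ :=
  planeMoment l l' i ((p : R4) 0) ((p : R4) 1) * planeMoment m m' j ((p : R4) 2) ((p : R4) 3)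

/-- Both sides compute the integral over `ℝ⁴` of the homogeneous integrand times `exp(-‖x‖²)`: on
the left in polar coordinates, on the right as a product over the two planes. -/
theorem integral_sphereMoment_mul_Gamma (l l' m m' : ℤ) (i j : ℕ) :
    (1 / 2 * Real.Gamma
        (((l.natAbs + l'.natAbs + 2 * i + (m.natAbs + m'.natAbs + 2 * j) : ℕ) + 4 : ℝ) / 2)) *
      ∫ p, sphereMoment l l' m m' i j p ∂((volume : Measure R4).toSphere) =
      ((1 / 2 * Real.Gamma (((l.natAbs + l'.natAbs + 2 * i + 1 : ℕ) + 1 : ℝ) / 2)) *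
        if l = l' then 2 ^ hat l * Real.pi else 0) *
      ((1 / 2 * Real.Gamma (((m.natAbs + m'.natAbs + 2 * j + 1 : ℕ) + 1 : ℝ) / 2)) *
        if m = m' then 2 ^ hat m * Real.pi else 0) := by
  rw [← integral_planeMoment_mul_exp, ← integral_planeMoment_mul_exp, ← integral_R4_mul,
    ← integral_volumeIoiPow_pow_mul_exp_neg_sq]
  refine (integral_norm_mul_radialExt (fun r => r ^ (l.natAbs + l'.natAbs + 2 * i +
    (m.natAbs + m'.natAbs + 2 * j)) * Real.exp (-r ^ 2)) _).symm.trans (integral_congr_ae ?_)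
  filter_upwards [Measure.ae_ne volume (0 : R4)] with x hx
  have hn : ‖x‖ ≠ 0 := norm_ne_zero_iff.mpr hx
  have h1 : ‖x‖ ^ 2 = x 0 ^ 2 + x 1 ^ 2 + (x 2 ^ 2 + x 3 ^ 2) := by
    rw [EuclideanSpace.norm_sq_eq]
    simp [Fin.sum_univ_four]
    ring
  rw [radialExt_of_ne_zero _ hx, sphereMoment]
  simp only [PiLp.smul_apply, smul_eq_mul, planeMoment_mul]
  rw [h1, neg_add, Real.exp_add, pow_add, inv_pow, inv_pow]
  field_simp

theorem integral_sphereMoment_eq_zero {l l' m m' : ℤ} (h : l ≠ l' ∨ m ≠ m') (i j : ℕ) :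
    ∫ p, sphereMoment l l' m m' i j p ∂((volume : Measure R4).toSphere) = 0 := by
  have h1 := integral_sphereMoment_mul_Gamma l l' m m' i j
  have h2 : (if l = l' then 2 ^ hat l * Real.pi else 0) *
      (if m = m' then 2 ^ hat m * Real.pi else 0) = 0 := by
    rcases h with h | h <;> simp [h]
  rw [mul_mul_mul_comm, h2, mul_zero] at h1
  refine (mul_eq_zero.mp h1).resolve_left (mul_pos one_half_pos (Real.Gamma_pos_of_pos ?_)).ne'
  positivity

theorem integral_sphereMoment_self (l m : ℤ) (i j : ℕ) :
    ∫ p, sphereMoment l l m m i j p ∂((volume : Measure R4).toSphere) =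
      2 ^ (hat l + hat m) * Real.pi ^ 2 / 2 * ((l.natAbs + i).factorial * (m.natAbs + j).factorial /
        (l.natAbs + m.natAbs + i + j + 1).factorial) := by
  have h1 := integral_sphereMoment_mul_Gamma l l m m i j
  have e1 : ((l.natAbs + l.natAbs + 2 * i + (m.natAbs + m.natAbs + 2 * j) : ℕ) + 4 : ℝ) / 2 =
      ((l.natAbs + m.natAbs + i + j + 1 : ℕ) : ℝ) + 1 := by push_cast; ring
  have e2 (n i : ℕ) : ((n + n + 2 * i + 1 : ℕ) + 1 : ℝ) / 2 = ((n + i : ℕ) : ℝ) + 1 := by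
    push_cast; ring
  rw [e1, e2, e2, Real.Gamma_nat_eq_factorial, Real.Gamma_nat_eq_factorial,
    Real.Gamma_nat_eq_factorial, if_pos rfl, if_pos rfl] at h1
  have hf : ((l.natAbs + m.natAbs + i + j + 1).factorial : ℝ) ≠ 0 := by positivity
  field_simp
  rw [pow_add]
  linear_combination 4 * h1

theorem continuous_coord (i : Fin 4) : Continuous fun p : S3 => (p : R4) i :=
  (EuclideanSpace.proj i : R4 →L[ℝ] ℝ).continuous.comp continuous_subtype_val

theorem integrable_S3 {f : S3 → ℝ} (hf : Continuous f) :
    Integrable f ((volume : Measure R4).toSphere) := by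
  exact hf.integrable_of_hasCompactSupport (HasCompactSupport.of_compactSpace f)

theorem continuous_planeHarm {X : Type*} [TopologicalSpace X] {x y : X → ℝ} (hx : Continuous x)
    (hy : Continuous y) (l : ℤ) : Continuous fun p => planeHarm (x p) (y p) l := by
  have h (n : ℕ) : Continuous (fun p => (planePow (x p) (y p) n).1) ∧
      Continuous (fun p => (planePow (x p) (y p) n).2) := by
    induction n with
    | zero => simp [planePow, continuous_const]
    | succ n ih =>
      obtain ⟨h1, h2⟩ := ih
      simp only [planePow]
      exact ⟨by fun_prop, by fun_prop⟩
  unfold planeHarm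
  split_ifs
  exacts [(h _).1, (h _).2]

/-! ### Jacobi polynomials -/

section Jacobi

open Polynomial

/-- The Jacobi polynomial `P_d^{(a,b)}(2 s - 1)` as a polynomial in `s`. -/
def jacobiPoly (a b d : ℕ) : ℝ[X] := jacobiForm a b d X (1 - X)

theorem jacobiPoly_eq_sum (a b d : ℕ) :
    jacobiPoly a b d = ∑ i ∈ Finset.range (d + 1),
      ((a + d).choose i * (b + d).choose (d - i) * (-1) ^ (d - i) : ℝ) •
        (X ^ i * (1 - X) ^ (d - i)) := by
  unfold jacobiPoly jacobiForm
  refine Finset.sum_congr rfl fun i _ => ?_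
  rw [smul_eq_C_mul, neg_pow (1 - X : ℝ[X])]
  simp
  ring

theorem natDegree_jacobiPoly_le (a b d : ℕ) : (jacobiPoly a b d).natDegree ≤ d := by
  rw [jacobiPoly_eq_sum]
  refine natDegree_sum_le_of_forall_le _ _ fun i hi => (natDegree_smul_le _ _).trans ?_
  have hi := Finset.mem_range.mp hi
  have h1 : ((1 - X : ℝ[X]) ^ (d - i)).natDegree ≤ (d - i) * 1 :=
    natDegree_pow_le_of_le _ (by compute_degree)
  have h2 : ((X : ℝ[X]) ^ i).natDegree ≤ i := natDegree_X_pow_le i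
  exact (natDegree_mul_le_of_le h2 h1).trans (by omega)

/-- Each `X^i (X - 1)^(d-i)` is monic of degree `d`, so the top coefficient is a Vandermonde
convolution. -/
theorem coeff_jacobiPoly (a b d : ℕ) :
    (jacobiPoly a b d).coeff d = ((a + b + 2 * d).choose d : ℝ) := by
  have h : a + b + 2 * d = (a + d) + (b + d) := by ring
  rw [h, Nat.add_choose_eq, Finset.Nat.sum_antidiagonal_eq_sum_range_succ_mk, jacobiPoly,
    jacobiForm, finsetSum_coeff]
  push_cast
  refine Finset.sum_congr rfl fun i hi => ?_
  have hi := Finset.mem_range.mp hi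
  have h1 : (X ^ i * (-(1 - X)) ^ (d - i) : ℝ[X]).coeff d = 1 := by
    have hm : (X ^ i * (X - C 1) ^ (d - i) : ℝ[X]).Monic :=
      (monic_X_pow i).mul ((monic_X_sub_C 1).pow _)
    have hd : (X ^ i * (X - C 1) ^ (d - i) : ℝ[X]).natDegree = d := by
      rw [(monic_X_pow i).natDegree_mul ((monic_X_sub_C 1).pow _), natDegree_X_pow,
        (monic_X_sub_C 1).natDegree_pow, natDegree_X_sub_C]
      omega
    have := hm.coeff_natDegree
    rw [hd] at this
    simpa using this
  have h2 : ((a + d).choose i : ℝ[X]) * ((b + d).choose (d - i) : ℝ[X]) * X ^ i *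
      (-(1 - X)) ^ (d - i) = C (((a + d).choose i : ℝ) * ((b + d).choose (d - i) : ℝ)) *
        (X ^ i * (-(1 - X)) ^ (d - i)) := by
    simp
    ring
  rw [h2, coeff_C_mul, h1, mul_one]

/-- The sum is the `d`-th forward difference at `b` of `x ↦ C(x, e)`, a polynomial of degree `e`
whose `e`-th difference is `1`. -/
theorem sum_neg_one_pow_choose_mul_choose (b d e : ℕ) (he : e ≤ d) :
    ∑ i ∈ Finset.range (d + 1), ((-1 : ℝ) ^ (d - i) * d.choose i) * (b + i).choose e =
      if e = d then 1 else 0 := by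
  have h := fwdDiff_iter_eq_sum_shift (1 : ℕ) (fun x => (x.choose e : ℤ)) d b
  have h2 : (fwdDiff (1 : ℕ))^[d] (fun x => (x.choose e : ℤ)) b = if e = d then 1 else 0 := by
    split_ifs with hed
    · subst hed
      simpa using congrFun (fwdDiff_iter_choose 0 e) b
    · obtain ⟨n, rfl⟩ : ∃ n, d = n + 1 + e := ⟨d - e - 1, by omega⟩
      have h3 : (fwdDiff (1 : ℕ))^[e] (fun x => (x.choose e : ℤ)) = fun _ => 1 := by
        simpa using fwdDiff_iter_choose 0 e
      rw [Function.iterate_add_apply, h3, Function.iterate_succ_apply, fwdDiff_const]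
      clear * -
      induction n with
      | zero => rfl
      | succ n ih => rw [Function.iterate_succ_apply, fwdDiff_const]; exact ih
  rw [h2] at h
  have h4 := congrArg (Int.cast (R := ℝ)) h
  push_cast at h4
  simp only [smul_eq_mul, mul_one] at h4
  rw [h4]
  push_cast
  rfl

/-- Coefficient times moment: the dependence on `i` is isolated in `C(d, i) C(b+e+i, e)`, the form
required by the finite difference. -/
theorem jacobi_coeff_mul_factorial (a b d e i : ℕ) (hi : i ≤ d) :
    ((a + d).choose i * (b + d).choose (d - i) : ℝ) *
        ((b + (i + e)).factorial * (a + (d - i)).factorial) =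
      (a + d).factorial * (b + d).factorial * e.factorial / d.factorial *
        (d.choose i * (b + e + i).choose e) := by
  obtain ⟨j, rfl⟩ : ∃ j, d = i + j := ⟨d - i, by omega⟩
  have e1 : a + (i + j) = i + (a + j) := by ring
  have e2 : b + (i + j) = j + (b + i) := by ring
  have e3 : b + e + i = e + (b + i) := by ring
  have e4 : b + (i + e) = e + (b + i) := by ring
  rw [Nat.add_sub_cancel_left, e1, e2, e3, e4, Nat.cast_add_choose, Nat.cast_add_choose,
    Nat.cast_add_choose, Nat.cast_add_choose]
  field_simp

end Jacobi

/-! ### Orthogonality and norms of the unnormalized modes -/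

section Orthonormal

open Polynomial

theorem modeFun_eq_jacobiPoly (l m : ℤ) (d : ℕ) (p : S3) :
    modeFun l m d p = planeHarm ((p : R4) 0) ((p : R4) 1) l *
      planeHarm ((p : R4) 2) ((p : R4) 3) m *
      (jacobiPoly m.natAbs l.natAbs d).eval ((p : R4) 0 ^ 2 + (p : R4) 1 ^ 2) := by
  have h : (p : R4) 2 ^ 2 + (p : R4) 3 ^ 2 = 1 - ((p : R4) 0 ^ 2 + (p : R4) 1 ^ 2) := by
    linarith [S3_sq_sum p]
  have h2 := map_jacobiForm (evalRingHom ((p : R4) 0 ^ 2 + (p : R4) 1 ^ 2))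
    m.natAbs l.natAbs d X (1 - X)
  simp only [coe_evalRingHom, eval_X, eval_sub, eval_one] at h2
  rw [modeFun, modeForm, h, jacobiPoly, h2]

/-- The integral of a product of two plane harmonics in each plane against a polynomial in the
squared radius `x² + y²`. -/
def harmInt (l l' m m' : ℤ) : ℝ[X] →ₗ[ℝ] ℝ where
  toFun q := ∫ p : S3, sphereMoment l l' m m' 0 0 p *
    q.eval ((p : R4) 0 ^ 2 + (p : R4) 1 ^ 2) ∂((volume : Measure R4).toSphere)
  map_add' q q' := by
    have hc := continuous_coord
    have hq (q : ℝ[X]) : Integrable (fun p : S3 => sphereMoment l l' m m' 0 0 p *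
        q.eval ((p : R4) 0 ^ 2 + (p : R4) 1 ^ 2)) ((volume : Measure R4).toSphere) := by
      refine integrable_S3 ?_
      unfold sphereMoment planeMoment
      have h1 := continuous_planeHarm (hc 0) (hc 1)
      have h2 := continuous_planeHarm (hc 2) (hc 3)
      have h3 := q.continuous.comp (((hc 0).pow 2).add ((hc 1).pow 2))
      simp only [pow_zero, mul_one]
      exact (((h1 l).mul (h1 l')).mul ((h2 m).mul (h2 m'))).mul h3
    simp only [eval_add, mul_add]
    exact integral_add (hq q) (hq q')
  map_smul' c q := by
    simp only [eval_smul, smul_eq_mul, mul_left_comm _ c, RingHom.id_apply]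
    exact integral_const_mul _ _

/-- On the sphere `1 - s = z² + w²`, so the mixed powers are the moments already computed. -/
theorem harmInt_X_pow_mul (l l' m m' : ℤ) (i j : ℕ) :
    harmInt l l' m m' (X ^ i * (1 - X) ^ j) =
      ∫ p, sphereMoment l l' m m' i j p ∂((volume : Measure R4).toSphere) := by
  refine integral_congr_ae (.of_forall fun p => ?_)
  have h : (p : R4) 2 ^ 2 + (p : R4) 3 ^ 2 = 1 - ((p : R4) 0 ^ 2 + (p : R4) 1 ^ 2) := by
    linarith [S3_sq_sum p]
  simp [sphereMoment, planeMoment, h]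
  ring

theorem sphereInner_modeFun (l l' m m' : ℤ) (d d' : ℕ) :
    sphereInner (modeFun l m d) (modeFun l' m' d') =
      harmInt l l' m m' (jacobiPoly m.natAbs l.natAbs d * jacobiPoly m'.natAbs l'.natAbs d') := by
  refine integral_congr_ae (.of_forall fun p => ?_)
  simp [sphereMoment, planeMoment, modeFun_eq_jacobiPoly]
  ring

theorem harmInt_eq_zero {l l' m m' : ℤ} (h : l ≠ l' ∨ m ≠ m') (q : ℝ[X]) :
    harmInt l l' m m' q = 0 := by
  rw [q.as_sum_range_C_mul_X_pow, map_sum]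
  refine Finset.sum_eq_zero fun i _ => ?_
  have h1 := harmInt_X_pow_mul l l' m m' i 0
  rw [integral_sphereMoment_eq_zero h, pow_zero, mul_one] at h1
  rw [← smul_eq_C_mul, map_smul, h1, smul_zero]

theorem harmInt_jacobiPoly_mul_X_pow (l m : ℤ) (d e : ℕ) (he : e ≤ d) :
    harmInt l l m m (jacobiPoly m.natAbs l.natAbs d * X ^ e) = if e = d then
      2 ^ (hat l + hat m) * Real.pi ^ 2 / 2 * ((l.natAbs + d).factorial * (m.natAbs + d).factorial /
        (l.natAbs + m.natAbs + 2 * d + 1).factorial) else 0 := by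
  set a := m.natAbs
  set b := l.natAbs
  set K : ℝ := 2 ^ (hat l + hat m) * Real.pi ^ 2 / 2
  have hterm : ∀ i ∈ Finset.range (d + 1),
      harmInt l l m m ((((a + d).choose i * (b + d).choose (d - i) * (-1) ^ (d - i) : ℝ) •
        (X ^ i * (1 - X) ^ (d - i))) * X ^ e) =
      K * ((a + d).factorial * (b + d).factorial * e.factorial / d.factorial) /
        (a + b + d + e + 1).factorial *
        (((-1 : ℝ) ^ (d - i) * d.choose i) * (b + e + i).choose e) := by
    intro i hi
    have hi := Finset.mem_range_succ_iff.mp hi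
    have h1 : (X ^ i * (1 - X) ^ (d - i) * X ^ e : ℝ[X]) = X ^ (i + e) * (1 - X) ^ (d - i) := by
      ring
    have h2 := jacobi_coeff_mul_factorial a b d e i hi
    have h3 : b + a + (i + e) + (d - i) + 1 = a + b + d + e + 1 := by omega
    rw [smul_mul_assoc, h1, map_smul, harmInt_X_pow_mul, integral_sphereMoment_self, smul_eq_mul,
      h3]
    linear_combination (K * (-1) ^ (d - i) / (a + b + d + e + 1).factorial) * h2
  rw [jacobiPoly_eq_sum, Finset.sum_mul, map_sum, Finset.sum_congr rfl hterm, ← Finset.mul_sum,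
    sum_neg_one_pow_choose_mul_choose _ _ _ he]
  split_ifs with h
  · subst h
    have h3 : a + b + e + e + 1 = b + a + 2 * e + 1 := by ring
    rw [h3]
    field_simp
  · simp

theorem harmInt_jacobiPoly_mul (l m : ℤ) (d : ℕ) (q : ℝ[X]) (hq : q.natDegree ≤ d) :
    harmInt l l m m (jacobiPoly m.natAbs l.natAbs d * q) = q.coeff d * (
      2 ^ (hat l + hat m) * Real.pi ^ 2 / 2 * ((l.natAbs + d).factorial * (m.natAbs + d).factorial /
        (l.natAbs + m.natAbs + 2 * d + 1).factorial)) := by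
  conv_lhs => rw [q.as_sum_range_C_mul_X_pow' (Nat.lt_succ_of_le hq)]
  rw [Finset.mul_sum, map_sum, Finset.sum_eq_single d]
  · rw [← smul_eq_C_mul, mul_smul_comm, map_smul, harmInt_jacobiPoly_mul_X_pow _ _ _ _ le_rfl,
      if_pos rfl, smul_eq_mul]
  · intro e he hed
    rw [← smul_eq_C_mul, mul_smul_comm, map_smul,
      harmInt_jacobiPoly_mul_X_pow _ _ _ _ (Finset.mem_range_succ_iff.mp he), if_neg hed, smul_zero]
  · simp

theorem sphereInner_comm (f g : S3 → ℝ) : sphereInner f g = sphereInner g f := by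
  simp only [sphereInner, mul_comm]

theorem sphereInner_modeFun_of_ne {l l' m m' : ℤ} {d d' : ℕ} (h : (l, m, d) ≠ (l', m', d')) :
    sphereInner (modeFun l m d) (modeFun l' m' d') = 0 := by
  by_cases hlm : l ≠ l' ∨ m ≠ m'
  · rw [sphereInner_modeFun, harmInt_eq_zero hlm]
  obtain ⟨rfl, rfl⟩ : l = l' ∧ m = m' := by push Not at hlm; exact hlm
  have key {d d' : ℕ} (hd : d' < d) : sphereInner (modeFun l m d) (modeFun l m d') = 0 := by
    have hn := natDegree_jacobiPoly_le m.natAbs l.natAbs d'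
    rw [sphereInner_modeFun, harmInt_jacobiPoly_mul _ _ _ _ (hn.trans hd.le),
      coeff_eq_zero_of_natDegree_lt (hn.trans_lt hd), zero_mul]
  have hd : d ≠ d' := fun e => h (by rw [e])
  rcases hd.lt_or_gt with hd | hd
  · rw [sphereInner_comm, key hd]
  · exact key hd

/-- Only the top coefficient `C(n, d)` of the second Jacobi factor contributes, where `n = |ℓ| + |m|
+ 2d`. Against the `(n+1)!` of the moment it leaves `(n+1) d! (n-d)!` in the denominator. -/
theorem sphereInner_modeFun_self (l m : ℤ) (d : ℕ) :
    sphereInner (modeFun l m d) (modeFun l m d) =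
      2 ^ (hat l + hat m) * Real.pi ^ 2 * (((l.natAbs + d).factorial * (m.natAbs + d).factorial) /
        (2 * (((l.natAbs + m.natAbs + 2 * d : ℕ) : ℝ) + 1) * d.factorial *
          (l.natAbs + m.natAbs + d).factorial)) := by
  rw [sphereInner_modeFun, harmInt_jacobiPoly_mul _ _ _ _ (natDegree_jacobiPoly_le _ _ _),
    coeff_jacobiPoly]
  have h : m.natAbs + l.natAbs + 2 * d = d + (l.natAbs + m.natAbs + d) := by ring
  have h' : l.natAbs + m.natAbs + 2 * d = d + (l.natAbs + m.natAbs + d) := by ring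
  rw [h, h', Nat.cast_add_choose, Nat.factorial_succ]
  push_cast
  field_simp

end Orthonormal

/-! ### Orthonormality of the modes -/

theorem modeDeg_spec {k : ℕ} (q : ModeIndex k) :
    q.1.1.natAbs + q.1.2.natAbs + 2 * modeDeg k q.1.1 q.1.2 = k := by
  obtain ⟨⟨l, m⟩, h1, h2⟩ := q
  have h3 : |l| + |m| ≤ (k : ℤ) := h1
  have h4 : (2 : ℤ) ∣ k - (l + m) := h2.dvd
  rw [Int.abs_eq_natAbs, Int.abs_eq_natAbs] at h3
  change l.natAbs + m.natAbs + 2 * ((k - (l.natAbs + m.natAbs)) / 2) = k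
  omega

theorem modeNorm_pos (k : ℕ) (l m : ℤ) : 0 < modeNorm k l m := by
  unfold modeNorm
  positivity

theorem modeNorm_sq_eq {k : ℕ} (q : ModeIndex k) :
    modeNorm k q.1.1 q.1.2 ^ 2 =
      sphereInner (modeFun q.1.1 q.1.2 (modeDeg k q.1.1 q.1.2))
        (modeFun q.1.1 q.1.2 (modeDeg k q.1.1 q.1.2)) := by
  rw [sphereInner_modeFun_self, modeDeg_spec q, modeNorm, mul_pow, mul_pow,
    Real.sq_sqrt (by positivity), Real.sq_sqrt (by positivity)]

theorem mode_eq_smul (k : ℕ) (l m : ℤ) :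
    mode k l m = (modeNorm k l m)⁻¹ • modeFun l m (modeDeg k l m) := by
  funext p
  rw [mode_eq_modeFun, Pi.smul_apply, smul_eq_mul, div_eq_inv_mul]

theorem sphereInner_smul_smul (c c' : ℝ) (f g : S3 → ℝ) :
    sphereInner (c • f) (c' • g) = c * c' * sphereInner f g := by
  rw [sphereInner, sphereInner, ← integral_const_mul]
  refine integral_congr_ae (.of_forall fun p => ?_)
  simp
  ring

theorem sphereInner_mode_self {k : ℕ} (q : ModeIndex k) :
    sphereInner (mode k q.1.1 q.1.2) (mode k q.1.1 q.1.2) = 1 := by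
  have h := (modeNorm_pos k q.1.1 q.1.2).ne'
  rw [mode_eq_smul, sphereInner_smul_smul, ← modeNorm_sq_eq]
  field_simp

/-- Since `k = |ℓ| + |m| + 2d`, distinct indices, even across wave numbers, give distinct triples
`(ℓ, m, d)`. -/
theorem sphereInner_mode_of_ne {q q' : (k : ℕ) × ModeIndex k} (h : q ≠ q') :
    sphereInner (mode q.1 q.2.1.1 q.2.1.2) (mode q'.1 q'.2.1.1 q'.2.1.2) = 0 := by
  rw [mode_eq_smul, mode_eq_smul, sphereInner_smul_smul, sphereInner_modeFun_of_ne, mul_zero]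
  contrapose! h
  obtain ⟨k, q⟩ := q
  obtain ⟨k', q'⟩ := q'
  have h1 := modeDeg_spec q
  have h2 := modeDeg_spec q'
  simp only [Prod.mk.injEq] at h
  obtain ⟨e1, e2, e3⟩ := h
  obtain rfl : k = k' := by rw [← h1, ← h2, e3, e1, e2]
  congr
  exact Subtype.ext (Prod.ext e1 e2)

/-! ### Density of the span of the modes -/

/-- The modes indexed by all wave numbers together. -/
def allModes (q : (k : ℕ) × ModeIndex k) : S3 → ℝ := mode q.1 q.2.1.1 q.2.1.2

/-- The linear span of all modes. -/
def modeSpan : Submodule ℝ (S3 → ℝ) := Submodule.span ℝ (Set.range allModes)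

theorem modeFun_mem_modeSpan (l m : ℤ) (d : ℕ) : modeFun l m d ∈ modeSpan := by
  let k := l.natAbs + m.natAbs + 2 * d
  let q : ModeIndex k := ⟨(l, m), by simp only [k, Int.abs_eq_natAbs]; omega, by
    refine Int.ModEq.symm (Int.modEq_iff_dvd.mpr ?_)
    simp only [k]
    omega⟩
  have hd : modeDeg k l m = d := by simp only [modeDeg, k]; omega
  have h : allModes ⟨k, q⟩ = (modeNorm k l m)⁻¹ • modeFun l m d := by
    rw [← hd]; exact mode_eq_smul k l m
  have h2 : modeFun l m d = modeNorm k l m • allModes ⟨k, q⟩ := by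
    rw [h, smul_smul, mul_inv_cancel₀ (modeNorm_pos k l m).ne', one_smul]
  rw [h2]
  exact Submodule.smul_mem _ _ (Submodule.subset_span ⟨_, rfl⟩)

open Polynomial in
/-- The Jacobi polynomials as a sequence with one polynomial of each degree. -/
def jacobiSequence (a b : ℕ) : Polynomial.Sequence ℝ where
  elems' := jacobiPoly a b
  degree_eq' d := by
    refine degree_eq_of_le_of_coeff_ne_zero
      (natDegree_le_iff_degree_le.mp (natDegree_jacobiPoly_le a b d)) ?_
    rw [coeff_jacobiPoly]
    exact_mod_cast (Nat.choose_pos (by omega)).ne'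

open Polynomial in
/-- A product of plane harmonics times a polynomial in the squared radius `x² + y²`. -/
def harmMul (l m : ℤ) : ℝ[X] →ₗ[ℝ] (S3 → ℝ) where
  toFun q p := planeHarm ((p : R4) 0) ((p : R4) 1) l * planeHarm ((p : R4) 2) ((p : R4) 3) m *
    q.eval ((p : R4) 0 ^ 2 + (p : R4) 1 ^ 2)
  map_add' q q' := by funext p; simp [mul_add]
  map_smul' c q := by funext p; simp; ring

/-- The Jacobi polynomials, one in each degree, span all polynomials in `s`. -/
theorem harmMul_mem_modeSpan (l m : ℤ) (q : Polynomial ℝ) : harmMul l m q ∈ modeSpan := by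
  have h := (jacobiSequence m.natAbs l.natAbs).span fun i => by
    simp
  have h2 : Submodule.span ℝ (Set.range (jacobiSequence m.natAbs l.natAbs)) ≤
      modeSpan.comap (harmMul l m) := by
    rw [Submodule.span_le]
    rintro _ ⟨d, rfl⟩
    have h3 : harmMul l m (jacobiPoly m.natAbs l.natAbs d) = modeFun l m d := by
      funext p
      exact (modeFun_eq_jacobiPoly l m d p).symm
    change harmMul l m (jacobiPoly m.natAbs l.natAbs d) ∈ modeSpan
    rw [h3]
    exact modeFun_mem_modeSpan l m d
  rw [h] at h2
  exact h2 trivial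

/-- The real (for `true`) or imaginary (for `false`) part of `(x + i y) ^ n`. -/
def planePart (c : Bool) (n : ℕ) (x y : ℝ) : ℝ :=
  if c then (planePow x y n).1 else (planePow x y n).2

theorem planeHarm_eq_planePart (l : ℤ) : ∃ c n, ∀ x y : ℝ, planeHarm x y l = planePart c n x y := by
  refine ⟨decide (0 ≤ l), l.natAbs, fun x y => ?_⟩
  simp [planeHarm, planePart]

theorem planePart_eq_planeHarm (c : Bool) (n : ℕ) :
    ∃ (r : ℝ) (l : ℤ), ∀ x y : ℝ, planePart c n x y = r * planeHarm x y l := by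
  cases c
  · rcases n with _ | n
    -- The imaginary part of `ζ^0` is zero and corresponds to no index `ℓ`, hence the scalar `0`.
    · exact ⟨0, 0, fun x y => by simp [planePart, planePow]⟩
    · refine ⟨1, -((n + 1 : ℕ) : ℤ), fun x y => ?_⟩
      rw [planeHarm, if_neg (by omega), Int.natAbs_neg, Int.natAbs_natCast]
      simp [planePart]
  · refine ⟨1, n, fun x y => ?_⟩
    simp [planePart, planeHarm]

/-- From `x = (ζ + ζ̄)/2`, `x ζ^(n+1) = (ζ^(n+2) + |ζ|² ζ^n)/2`. -/
theorem fst_mul_planePart (c : Bool) (n : ℕ) : ∃ (r r' : ℝ) (c' : Bool) (n₁ n₂ : ℕ), ∀ x y : ℝ,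
    x * planePart c n x y =
      r * planePart c' n₁ x y + r' * ((x ^ 2 + y ^ 2) * planePart c' n₂ x y) := by
  rcases n with _ | n
  · cases c
    · exact ⟨0, 0, true, 0, 0, fun x y => by simp [planePart, planePow]⟩
    · exact ⟨1, 0, true, 1, 0, fun x y => by simp [planePart, planePow]⟩
  · refine ⟨1 / 2, 1 / 2, c, n + 2, n, fun x y => ?_⟩
    cases c <;> simp [planePart, planePow] <;> ring

/-- From `y = (ζ - ζ̄)/(2i)`, `y ζ^(n+1) = (ζ^(n+2) - |ζ|² ζ^n)/(2i)`; dividing by `i` exchanges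
real and imaginary parts. -/
theorem snd_mul_planePart (c : Bool) (n : ℕ) : ∃ (r r' : ℝ) (c' : Bool) (n₁ n₂ : ℕ), ∀ x y : ℝ,
    y * planePart c n x y =
      r * planePart c' n₁ x y + r' * ((x ^ 2 + y ^ 2) * planePart c' n₂ x y) := by
  rcases n with _ | n
  · cases c
    · exact ⟨0, 0, true, 0, 0, fun x y => by simp [planePart, planePow]⟩
    · exact ⟨1, 0, false, 1, 0, fun x y => by simp [planePart, planePow]⟩
  · cases c
    · refine ⟨-1 / 2, 1 / 2, true, n + 2, n, fun x y => ?_⟩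
      simp [planePart, planePow]; ring
    · refine ⟨1 / 2, -1 / 2, false, n + 2, n, fun x y => ?_⟩
      simp [planePart, planePow]; ring

/-- A product of parts of powers in the two planes with a polynomial in `x² + y²`. -/
def partMul (c c' : Bool) (n n' : ℕ) (q : Polynomial ℝ) (p : S3) : ℝ :=
  planePart c n ((p : R4) 0) ((p : R4) 1) * planePart c' n' ((p : R4) 2) ((p : R4) 3) *
    q.eval ((p : R4) 0 ^ 2 + (p : R4) 1 ^ 2)

theorem partMul_mem_modeSpan (c c' : Bool) (n n' : ℕ) (q : Polynomial ℝ) :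
    partMul c c' n n' q ∈ modeSpan := by
  obtain ⟨r, l, h⟩ := planePart_eq_planeHarm c n
  obtain ⟨r', m, h'⟩ := planePart_eq_planeHarm c' n'
  have : partMul c c' n n' q = (r * r') • harmMul l m q := by
    funext p
    simp only [partMul, h, h', Pi.smul_apply, smul_eq_mul, harmMul, LinearMap.coe_mk,
      AddHom.coe_mk]
    ring
  rw [this]
  exact Submodule.smul_mem _ _ (harmMul_mem_modeSpan l m q)

/-- The squared radius produced by a coordinate is absorbed into the polynomial in `s`: as `X` for
the first plane, as `1 - X` for the second. -/
theorem coord_mul_partMul_mem (i : Fin 4) (c c' : Bool) (n n' : ℕ) (q : Polynomial ℝ) :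
    (fun p : S3 => (p : R4) i * partMul c c' n n' q p) ∈ modeSpan := by
  have hfst {g : ℝ → ℝ → ℝ} {i : Fin 4} (hg : ∀ p : S3, (p : R4) i = g ((p : R4) 0) ((p : R4) 1))
      (h : ∃ (r r' : ℝ) (c' : Bool) (n₁ n₂ : ℕ), ∀ x y : ℝ, g x y * planePart c n x y =
        r * planePart c' n₁ x y + r' * ((x ^ 2 + y ^ 2) * planePart c' n₂ x y)) :
      (fun p : S3 => (p : R4) i * partMul c c' n n' q p) ∈ modeSpan := by
    obtain ⟨r, r', b, n₁, n₂, h⟩ := h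
    have : (fun p : S3 => (p : R4) i * partMul c c' n n' q p) =
        r • partMul b c' n₁ n' q + r' • partMul b c' n₂ n' (Polynomial.X * q) := by
      funext p
      rw [hg]
      simp only [partMul, ← mul_assoc, h, Pi.add_apply, Pi.smul_apply, smul_eq_mul,
        Polynomial.eval_mul, Polynomial.eval_X]
      ring
    rw [this]
    exact add_mem (Submodule.smul_mem _ _ (partMul_mem_modeSpan _ _ _ _ _))
      (Submodule.smul_mem _ _ (partMul_mem_modeSpan _ _ _ _ _))
  have hsnd {g : ℝ → ℝ → ℝ} {i : Fin 4} (hg : ∀ p : S3, (p : R4) i = g ((p : R4) 2) ((p : R4) 3))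
      (h : ∃ (r r' : ℝ) (b : Bool) (n₁ n₂ : ℕ), ∀ x y : ℝ, g x y * planePart c' n' x y =
        r * planePart b n₁ x y + r' * ((x ^ 2 + y ^ 2) * planePart b n₂ x y)) :
      (fun p : S3 => (p : R4) i * partMul c c' n n' q p) ∈ modeSpan := by
    obtain ⟨r, r', b, n₁, n₂, h⟩ := h
    have : (fun p : S3 => (p : R4) i * partMul c c' n n' q p) =
        r • partMul c b n n₁ q + r' • partMul c b n n₂ ((1 - Polynomial.X) * q) := by
      funext p
      have hs : (p : R4) 2 ^ 2 + (p : R4) 3 ^ 2 = 1 - ((p : R4) 0 ^ 2 + (p : R4) 1 ^ 2) := by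
        linarith [S3_sq_sum p]
      have h := h ((p : R4) 2) ((p : R4) 3)
      rw [hs] at h
      rw [hg]
      simp only [partMul, Pi.add_apply, Pi.smul_apply, smul_eq_mul,
        Polynomial.eval_mul, Polynomial.eval_X, Polynomial.eval_sub, Polynomial.eval_one]
      linear_combination (planePart c n ((p : R4) 0) ((p : R4) 1) *
        q.eval ((p : R4) 0 ^ 2 + (p : R4) 1 ^ 2)) * h
    rw [this]
    exact add_mem (Submodule.smul_mem _ _ (partMul_mem_modeSpan _ _ _ _ _))
      (Submodule.smul_mem _ _ (partMul_mem_modeSpan _ _ _ _ _))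
  fin_cases i
  · exact hfst (g := fun x _ => x) (fun _ => rfl) (fst_mul_planePart c n)
  · exact hfst (g := fun _ y => y) (fun _ => rfl) (snd_mul_planePart c n)
  · exact hsnd (g := fun x _ => x) (fun _ => rfl) (fst_mul_planePart c' n')
  · exact hsnd (g := fun _ y => y) (fun _ => rfl) (snd_mul_planePart c' n')

theorem coord_mul_mem_modeSpan (i : Fin 4) {f : S3 → ℝ} (hf : f ∈ modeSpan) :
    (fun p : S3 => (p : R4) i * f p) ∈ modeSpan := by
  induction hf using Submodule.span_induction with
  | mem f hf =>
    obtain ⟨q, rfl⟩ := hf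
    obtain ⟨c, n, h⟩ := planeHarm_eq_planePart q.2.1.1
    obtain ⟨c', n', h'⟩ := planeHarm_eq_planePart q.2.1.2
    have : (fun p : S3 => (p : R4) i * allModes q p) = (modeNorm q.1 q.2.1.1 q.2.1.2)⁻¹ •
        fun p : S3 => (p : R4) i * partMul c c' n n' (jacobiPoly q.2.1.2.natAbs q.2.1.1.natAbs
          (modeDeg q.1 q.2.1.1 q.2.1.2)) p := by
      funext p
      simp only [allModes, mode_eq_smul, Pi.smul_apply, smul_eq_mul, modeFun_eq_jacobiPoly, h, h',
        partMul]
      ring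
    rw [this]
    exact Submodule.smul_mem _ _ (coord_mul_partMul_mem _ _ _ _ _ _)
  | zero =>
    simp only [Pi.zero_apply, mul_zero]
    exact modeSpan.zero_mem
  | add f g _ _ hf hg =>
    simp only [Pi.add_apply, mul_add]
    exact add_mem hf hg
  | smul c f _ hf =>
    simp only [Pi.smul_apply, smul_eq_mul, mul_left_comm _ c]
    exact Submodule.smul_mem _ c hf

/-- The coordinate functions on the sphere, as continuous maps. -/
def coordMap (i : Fin 4) : C(S3, ℝ) := ⟨fun p => (p : R4) i, continuous_coord i⟩

/-- The algebra of polynomial functions on the sphere. -/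
def coordAlgebra : Subalgebra ℝ C(S3, ℝ) := Algebra.adjoin ℝ (Set.range coordMap)

/-- The span is a module over the coordinate algebra and contains the constant `1`, which is the
mode form with `ℓ = m = d = 0`. -/
theorem coordAlgebra_le_modeSpan {g : C(S3, ℝ)} (hg : g ∈ coordAlgebra) : ⇑g ∈ modeSpan := by
  have key : ∀ f ∈ modeSpan, (fun p => g p * f p) ∈ modeSpan := by
    induction hg using Algebra.adjoin_induction with
    | mem g hg =>
      obtain ⟨i, rfl⟩ := hg
      exact fun f hf => coord_mul_mem_modeSpan i hf
    | algebraMap r => exact fun f hf => modeSpan.smul_mem r hf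
    | add g g' _ _ hg hg' =>
      intro f hf
      simp only [ContinuousMap.add_apply, add_mul]
      exact add_mem (hg f hf) (hg' f hf)
    | mul g g' _ _ hg hg' =>
      intro f hf
      simpa only [ContinuousMap.mul_apply, mul_assoc] using hg _ (hg' f hf)
  have h1 : modeFun 0 0 0 = fun _ => 1 := by
    funext p
    simp [modeFun, modeForm, planeHarm, planePow, jacobiForm]
  simpa [h1] using key _ (modeFun_mem_modeSpan 0 0 0)

theorem coordAlgebra_dense : coordAlgebra.topologicalClosure = ⊤ := by
  refine ContinuousMap.subalgebra_topologicalClosure_eq_top_of_separatesPoints _ ?_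
  intro p q hpq
  have h : ∃ i, (p : R4) i ≠ (q : R4) i := by
    by_contra! h
    exact hpq (Subtype.ext (PiLp.ext h))
  obtain ⟨i, hi⟩ := h
  exact ⟨coordMap i, ⟨coordMap i, Algebra.subset_adjoin ⟨i, rfl⟩, rfl⟩, hi⟩

theorem continuous_allModes (q : (k : ℕ) × ModeIndex k) : Continuous (allModes q) := by
  rw [allModes, mode_eq_smul]
  exact (smoothOnS3_modeFun _ _ _).continuous.const_smul _

theorem sphereInner_add_right {f g g' : S3 → ℝ} (hf : Continuous f) (hg : Continuous g)
    (hg' : Continuous g') : sphereInner f (g + g') = sphereInner f g + sphereInner f g' := by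
  simp only [sphereInner, Pi.add_apply, mul_add]
  exact integral_add (integrable_S3 (hf.mul hg)) (integrable_S3 (hf.mul hg'))

theorem sphereInner_smul_right (c : ℝ) (f g : S3 → ℝ) :
    sphereInner f (c • g) = c * sphereInner f g := by
  simpa using sphereInner_smul_smul 1 c f g

theorem sphereInner_sum_right {ι : Type*} {f : S3 → ℝ} (hf : Continuous f) {v : ι → S3 → ℝ}
    (hv : ∀ i, Continuous (v i)) (c : ι → ℝ) (s : Finset ι) :
    sphereInner f (∑ i ∈ s, c i • v i) = ∑ i ∈ s, c i * sphereInner f (v i) := by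
  classical
  induction s using Finset.induction_on with
  | empty => simp [sphereInner]
  | insert i s hi ih =>
    have hs : Continuous (∑ j ∈ s, c j • v j) := by
      rw [Finset.sum_fn]
      exact continuous_finsetSum s fun j _ => (hv j).const_smul (c j)
    rw [Finset.sum_insert hi, Finset.sum_insert hi, sphereInner_add_right hf
      ((hv i).const_smul _) hs, ih,
      sphereInner_smul_right]

/-- If `g` in the span is uniformly within `ε` of `f`, then `⟨f, f⟩ = ⟨f, f - g⟩ ≤ ε ∫ |f|`. -/
theorem eq_zero_of_sphereInner_allModes {f : S3 → ℝ} (hf : Continuous f)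
    (h : ∀ q, sphereInner f (allModes q) = 0) : f = 0 := by
  have h1 : ∀ g ∈ modeSpan, Continuous g ∧ sphereInner f g = 0 := by
    intro g hg
    induction hg using Submodule.span_induction with
    | mem g hg =>
      obtain ⟨q, rfl⟩ := hg
      exact ⟨continuous_allModes q, h q⟩
    | zero => exact ⟨continuous_const, by simp [sphereInner]⟩
    | add g g' _ _ hg hg' =>
      exact ⟨hg.1.add hg'.1, by rw [sphereInner_add_right hf hg.1 hg'.1, hg.2, hg'.2, add_zero]⟩
    | smul c g _ hg => exact ⟨hg.1.const_smul c, by rw [sphereInner_smul_right, hg.2, mul_zero]⟩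
  let F : C(S3, ℝ) := ⟨f, hf⟩
  have h2 : F ∈ closure (coordAlgebra : Set C(S3, ℝ)) := by
    have : F ∈ coordAlgebra.topologicalClosure := by rw [coordAlgebra_dense]; trivial
    exact this
  set C := ∫ p, |f p| ∂((volume : Measure R4).toSphere) with hC
  have hC0 : 0 ≤ C := integral_nonneg fun p => abs_nonneg _
  have h3 (ε : ℝ) (hε : 0 < ε) : sphereInner f f ≤ ε * C := by
    obtain ⟨g, hg, hd⟩ := Metric.mem_closure_iff.mp h2 ε hε
    have hg0 := (h1 g (coordAlgebra_le_modeSpan hg)).2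
    have e1 : sphereInner f f = sphereInner f g + sphereInner f (f - ⇑g) := by
      rw [← sphereInner_add_right hf g.continuous (hf.sub g.continuous)]
      congr 1
      simp
    rw [e1, hg0, zero_add, hC, ← integral_const_mul]
    refine integral_mono (integrable_S3 (hf.mul (hf.sub g.continuous)))
      (integrable_S3 (continuous_const.mul hf.abs)) fun p => ?_
    have e2 : |f p - g p| ≤ ε := by
      rw [← Real.dist_eq]
      exact (ContinuousMap.dist_apply_le_dist (f := F) (g := g) p).trans hd.le
    calc f p * (f p - g p) ≤ |f p * (f p - g p)| := le_abs_self _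
      _ = |f p - g p| * |f p| := by rw [abs_mul, mul_comm]
      _ ≤ ε * |f p| := by gcongr
  have h4 : sphereInner f f ≤ 0 := by
    refine le_of_forall_pos_le_add fun δ hδ => ?_
    -- `C + 1` is used because `C` may be zero.
    have := h3 (δ / (C + 1)) (by positivity)
    refine this.trans ?_
    rw [zero_add, div_mul_eq_mul_div, div_le_iff₀ (by positivity)]
    nlinarith
  by_contra hne
  obtain ⟨p, hp⟩ : ∃ p, f p ≠ 0 := by
    by_contra! hz
    exact hne (funext hz)
  refine h4.not_gt (Continuous.integral_pos_of_hasCompactSupport_nonneg_nonzero (x := p)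
    (hf.mul hf) (HasCompactSupport.of_compactSpace _) (fun q => mul_self_nonneg _) ?_)
  exact mul_self_ne_zero.mpr hp

/-! ### The eigenspaces -/

theorem mode_mem_eigenspace {k : ℕ} (q : ModeIndex k) :
    mode k q.1.1 q.1.2 ∈ eigenspace (-((k : ℝ) * ((k : ℝ) + 2))) := by
  rw [mode_eq_smul]
  refine Submodule.smul_mem _ _ ⟨smoothOnS3_modeFun _ _ _, fun p => ?_⟩
  rw [sphereLaplacian_modeFun, modeDeg_spec q]

/-- Eigenfunctions of a symmetric operator for distinct eigenvalues are orthogonal. -/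
theorem sphereInner_allModes_eq_zero {μ : ℝ} {f : S3 → ℝ} (hf : f ∈ eigenspace μ)
    (q : (k : ℕ) × ModeIndex k) (hμ : μ ≠ -((q.1 : ℝ) * ((q.1 : ℝ) + 2))) :
    sphereInner f (allModes q) = 0 := by
  have hm := mode_mem_eigenspace q.2
  have h := sphereInner_sphereLaplacian_comm hf.1 hm.1
  have h1 : sphereLaplacian f = μ • f := funext hf.2
  have h2 : sphereLaplacian (mode q.1 q.2.1.1 q.2.1.2) =
      (-((q.1 : ℝ) * ((q.1 : ℝ) + 2))) • allModes q := funext hm.2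
  rw [h1, h2, sphereInner_smul_right, sphereInner_comm (μ • f), sphereInner_smul_right,
    sphereInner_comm _ f] at h
  have h3 : (μ - -((q.1 : ℝ) * ((q.1 : ℝ) + 2))) * sphereInner f (allModes q) = 0 := by
    rw [sub_mul, h]
    exact sub_self _
  exact (mul_eq_zero.mp h3).resolve_left (sub_ne_zero.mpr hμ)

theorem finite_modeIndex (k : ℕ) : Finite (ModeIndex k) := by
  refine Set.Finite.subset ((Set.finite_Icc (-(k : ℤ)) k).prod (Set.finite_Icc (-(k : ℤ)) k)) ?_
  rintro ⟨l, m⟩ ⟨h, -⟩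
  have h : |l| + |m| ≤ (k : ℤ) := h
  have h1 := abs_le.mp ((le_add_of_nonneg_right (abs_nonneg m)).trans h)
  have h2 := abs_le.mp ((le_add_of_nonneg_left (abs_nonneg l)).trans h)
  exact ⟨h1, h2⟩

theorem eigenspace_le_span (k : ℕ) : eigenspace (-((k : ℝ) * ((k : ℝ) + 2))) ≤
    Submodule.span ℝ (Set.range fun q : ModeIndex k => mode k q.1.1 q.1.2) := by
  classical
  intro f hf
  have := finite_modeIndex k
  have := Fintype.ofFinite (ModeIndex k)
  have hcf : Continuous f := hf.1.continuous
  have hcv (q : ModeIndex k) : Continuous (mode k q.1.1 q.1.2) := continuous_allModes ⟨k, q⟩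
  set g : S3 → ℝ := ∑ q : ModeIndex k, sphereInner f (mode k q.1.1 q.1.2) • mode k q.1.1 q.1.2
    with hg
  have hgE : g ∈ eigenspace (-((k : ℝ) * ((k : ℝ) + 2))) :=
    Submodule.sum_mem _ fun q _ => Submodule.smul_mem _ _ (mode_mem_eigenspace q)
  have hgs : g ∈ Submodule.span ℝ (Set.range fun q : ModeIndex k => mode k q.1.1 q.1.2) :=
    Submodule.sum_mem _ fun q _ => Submodule.smul_mem _ _ (Submodule.subset_span ⟨q, rfl⟩)
  have h0 : f - g = 0 := by
    refine eq_zero_of_sphereInner_allModes (hcf.sub hgE.1.continuous) fun ⟨k', q'⟩ => ?_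
    by_cases hk : k' = k
    · subst hk
      have e1 : sphereInner (f - g) (allModes ⟨k', q'⟩) =
          sphereInner (allModes ⟨k', q'⟩) f + -1 * sphereInner (allModes ⟨k', q'⟩) g := by
        rw [← sphereInner_smul_right, ← sphereInner_add_right (continuous_allModes _) hcf
          (hgE.1.continuous.const_smul _), sphereInner_comm]
        congr 1
        simp [sub_eq_add_neg]
      rw [e1, hg, sphereInner_sum_right (continuous_allModes _) hcv, Finset.sum_eq_single q',
        allModes, sphereInner_mode_self, sphereInner_comm f]
      · ring
      · intro q _ hq
        rw [show sphereInner (allModes ⟨k', q'⟩) (mode k' q.1.1 q.1.2) = 0 from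
          sphereInner_mode_of_ne (q := ⟨k', q'⟩) (q' := ⟨k', q⟩) (by simpa using hq.symm), mul_zero]
      · simp
    · refine sphereInner_allModes_eq_zero (sub_mem hf hgE) ⟨k', q'⟩ fun h => hk ?_
      -- `k(k+2) - k'(k'+2)` factors this way, so distinct wave numbers have distinct eigenvalues.
      have h1 : ((k : ℝ) - k') * (k + k' + 2) = 0 := by
        simp only at h
        linear_combination -h
      have h2 : (k : ℝ) + k' + 2 ≠ 0 := by positivity
      exact_mod_cast (sub_eq_zero.mp ((mul_eq_zero.mp h1).resolve_right h2)).symm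
  rw [sub_eq_zero.mp h0]
  exact hgs

theorem eigenspace_eq_bot {μ : ℝ} (hμ : ∀ k : ℕ, μ ≠ -((k : ℝ) * ((k : ℝ) + 2))) :
    eigenspace μ = ⊥ := by
  rw [eq_bot_iff]
  intro f hf
  exact eq_zero_of_sphereInner_allModes hf.1.continuous fun q =>
    sphereInner_allModes_eq_zero hf q (hμ q.1)

theorem linearIndependent_of_sphereInner {ι : Type*} {v : ι → S3 → ℝ}
    (hv : ∀ i, Continuous (v i)) (h1 : ∀ i, sphereInner (v i) (v i) = 1)
    (h0 : ∀ i j, i ≠ j → sphereInner (v i) (v j) = 0) : LinearIndependent ℝ v := by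
  rw [linearIndependent_iff']
  intro s c hc i hi
  have h := sphereInner_sum_right (hv i) hv c s
  rw [hc, Finset.sum_eq_single_of_mem i hi fun j _ hj => by rw [h0 i j hj.symm, mul_zero], h1] at h
  simpa [sphereInner] using h.symm

end ToroidalModes

end

/-! ### Proof of the theorem -/

open ToroidalModes in
theorem theorem1 :
    -- in toroidal coordinates, the functions `mode k ℓ m` on the sphere are given by the formula
    (∀ (k : ℕ) (q : ModeIndex k) (χ θ φ : ℝ), 0 ≤ χ → χ ≤ Real.pi / 2 →
      mode k q.1.1 q.1.2 (torPoint χ θ φ) = modeCoord k q.1.1 q.1.2 χ θ φ) ∧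
    -- for each wave number they form an orthonormal basis of the eigenspace
    (∀ k : ℕ, IsOrthonormalBasisOf (fun q : ModeIndex k => mode k q.1.1 q.1.2)
      (eigenspace (-((k : ℝ) * ((k : ℝ) + 2))))) ∧
    -- over all wave numbers together, they form an orthonormal basis of the span of all
    -- eigenfunctions of the Laplacian
    IsOrthonormalBasisOf (fun q : (k : ℕ) × ModeIndex k => mode q.1 q.2.1.1 q.2.1.2)
      (⨆ μ : ℝ, eigenspace μ) := by
  refine ⟨fun k q χ θ φ _ _ => mode_torPoint k _ _ χ θ φ, fun k => ?_, ?_⟩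
  · have h0 (q q' : ModeIndex k) (h : q ≠ q') :
        sphereInner (mode k q.1.1 q.1.2) (mode k q'.1.1 q'.1.2) = 0 :=
      sphereInner_mode_of_ne (q := ⟨k, q⟩) (q' := ⟨k, q'⟩) (by simpa using h)
    refine ⟨sphereInner_mode_self, h0, linearIndependent_of_sphereInner
      (fun q => continuous_allModes ⟨k, q⟩) sphereInner_mode_self h0,
      le_antisymm ?_ (eigenspace_le_span k)⟩
    rw [Submodule.span_le]
    rintro _ ⟨q, rfl⟩
    exact mode_mem_eigenspace q
  · refine ⟨fun q => sphereInner_mode_self q.2, fun q q' => sphereInner_mode_of_ne,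
      linearIndependent_of_sphereInner continuous_allModes (fun q => sphereInner_mode_self q.2)
        fun q q' => sphereInner_mode_of_ne, le_antisymm ?_ (iSup_le fun μ => ?_)⟩
    · rw [Submodule.span_le]
      rintro _ ⟨q, rfl⟩
      exact Submodule.mem_iSup_of_mem _ (mode_mem_eigenspace q.2)
    -- An eigenspace is zero unless `μ` is one of the values `-k(k+2)`, so only these enter the
    -- supremum.
    · by_cases hμ : ∀ k : ℕ, μ ≠ -((k : ℝ) * ((k : ℝ) + 2))
      · rw [eigenspace_eq_bot hμ]
        exact bot_le
      · push Not at hμ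
        obtain ⟨k, rfl⟩ := hμ
        refine (eigenspace_le_span k).trans (Submodule.span_mono ?_)
        rintro _ ⟨q, rfl⟩
        exact ⟨⟨k, q⟩, rfl⟩
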